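/- Let $d\in\{2,3\}$, $k>0$, and let $$\Phi(x,y)=\begin{cases}\frac{i}{4}H^{(1)}_0(k|x-y|), & d=2,\\[2pt] \dfrac{e^{ik|x-y|}}{4\pi|x-y|}, & d=3,\end{cases}\qquad x\neq y\in\mathbb{R}^d,$$ be the radiating Green function of the Helmholtz equation, where $H_0^{(1)}=J_0+iY_0$ is the Hankel function of the first kind of order zero. Denote by $\operatorname{Im}\Phi(x,y)$ its imaginary part, extended continuously to $x=y$ (with value $\frac14$ if $d=2$ and $\frac{k}{4\pi}$ if $d=3$). Let $\Omega\subset\mathbb{R}^d$ be a regular bounded domain, i.e. a bounded connected open set with $C^1$ boundary, with outward unit normal $\nu$ and surface measure $ds$ on $\partial\Omega$. Let $N\in\mathbb{N}$, $x_1,\dots,x_N\in\Omega$, $\alpha_1,\dots,\alpha_N\in\mathbb{C}$, and let $$u(x)=\sum_{j=1}^N\alpha_j\,\Phi(x,x_j)$$ be the radiating field generated by the point sources at $x_j$ with intensities $\alpha_j$. Then for every $z\in\mathbb{R}^d$ the integrand below is integrable on $\partial\Omega$ and $$\int_{\partial\Omega}\left(\frac{\partial \operatorname{Im}\Phi(x,z)}{\partial\nu(x)}\,u(x)-\operatorname{Im}\Phi(x,z)\,\frac{\partial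 u(x)}{\partial\nu(x)}\right)ds(x)=\sum_{j=1}^N\alpha_j\operatorname{Im}\Phi(x_j,z).$$ -/

import Mathlib

open Set Filter Topology MeasureTheory Metric
open scoped InnerProductSpace Nat

noncomputable section

namespace InverseSource

/-! ### Regular bounded domains, outward normal, surface integral -/

/-- The boundary of `Ω` is of class `C¹`: near each boundary point `p`, for a suitable unit vector
`e` and a suitable `C¹` function `γ` on the hyperplane `e^⊥`, the set `Ω` consists of exactly the
points lying below the graph of `γ` in the direction `e`. -/
def HasC1Boundary {d : ℕ} (Ω : Set (EuclideanSpace ℝ (Fin d))) : Prop :=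
  ∀ p ∈ frontier Ω, ∃ e : EuclideanSpace ℝ (Fin d), ‖e‖ = 1 ∧
    ∃ γ : (Submodule.span ℝ {e})ᗮ → ℝ, ContDiff ℝ 1 γ ∧
      ∃ r > 0, ∀ x ∈ ball p r,
        (x ∈ Ω ↔ ⟪e, x⟫_ℝ < γ ((Submodule.span ℝ {e})ᗮ.orthogonalProjectionOnto x))

/-- A regular bounded domain of `ℝ^d`: a bounded, connected open set with boundary of
class `C¹`. -/
structure IsRegularBoundedDomain {d : ℕ} (Ω : Set (EuclideanSpace ℝ (Fin d))) : Prop where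
  isOpen : IsOpen Ω
  isConnected : IsConnected Ω
  isBounded : Bornology.IsBounded Ω
  hasC1Boundary : HasC1Boundary Ω

/-- `n` is the outward unit normal of `Ω` at `p`: a unit vector such that rays issued from `p`
start inside `Ω` in the directions making an obtuse angle with `n`, and start outside `Ω` in the
directions making an acute angle with `n`. -/
def IsOutwardUnitNormal {d : ℕ} (Ω : Set (EuclideanSpace ℝ (Fin d)))
    (p n : EuclideanSpace ℝ (Fin d)) : Prop :=
  ‖n‖ = 1 ∧ ∀ w : EuclideanSpace ℝ (Fin d),
    (⟪n, w⟫_ℝ < 0 → ∀ᶠ t : ℝ in 𝓝[>] 0, p + t • w ∈ Ω) ∧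
    (0 < ⟪n, w⟫_ℝ → ∀ᶠ t : ℝ in 𝓝[>] 0, p + t • w ∉ Ω)

open Classical in
/-- The outward unit normal `ν(p)` (it exists and is unique at the boundary points of a domain
with `C¹` boundary; elsewhere the value is irrelevant). -/
def outwardNormal {d : ℕ} (Ω : Set (EuclideanSpace ℝ (Fin d)))
    (p : EuclideanSpace ℝ (Fin d)) : EuclideanSpace ℝ (Fin d) :=
  if h : ∃ n, IsOutwardUnitNormal Ω p n then h.choose else 0

/-- The derivative `∂f/∂ν` of `f` in the direction of the outward unit normal of `Ω`. -/
def normalDeriv {d : ℕ} (Ω : Set (EuclideanSpace ℝ (Fin d))) {F : Type*} [NormedAddCommGroup F]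
    [NormedSpace ℝ F] (f : EuclideanSpace ℝ (Fin d) → F) (p : EuclideanSpace ℝ (Fin d)) : F :=
  fderiv ℝ f p (outwardNormal Ω p)

/-- The surface measure `ds` on `∂Ω`: the `(d-1)`-dimensional Hausdorff measure, normalized to
agree with Lebesgue measure on `(d-1)`-dimensional Euclidean space, restricted to `∂Ω`. -/
def surfaceMeasure {d : ℕ} (Ω : Set (EuclideanSpace ℝ (Fin d))) :
    Measure (EuclideanSpace ℝ (Fin d)) :=
  (Measure.euclideanHausdorffMeasure (d - 1)).restrict (frontier Ω)

/-- An outward unit normal is unique. -/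
theorem IsOutwardUnitNormal.unique {d : ℕ} {Ω : Set (EuclideanSpace ℝ (Fin d))}
    {p n m : EuclideanSpace ℝ (Fin d)} (hn : IsOutwardUnitNormal Ω p n)
    (hm : IsOutwardUnitNormal Ω p m) : n = m := by
  by_contra hne
  have hpos : 0 < ‖m - n‖ ^ 2 := by
    have : m - n ≠ 0 := sub_ne_zero.2 (Ne.symm hne)
    positivity
  have key : ‖m - n‖ ^ 2 = 2 - 2 * ⟪n, m⟫_ℝ := by
    rw [norm_sub_sq_real, hn.1, hm.1, real_inner_comm]; ring
  have h1 : ⟪n, m - n⟫_ℝ < 0 := by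
    rw [inner_sub_right, real_inner_self_eq_norm_sq, hn.1]; linarith
  have h2 : 0 < ⟪m, m - n⟫_ℝ := by
    rw [inner_sub_right, real_inner_self_eq_norm_sq, hm.1, real_inner_comm]; linarith
  obtain ⟨t, ht1, ht2⟩ := (((hn.2 _).1 h1).and ((hm.2 _).2 h2)).exists
  exact ht2 ht1

/-- At the boundary points of an open set with `C¹` boundary, `outwardNormal` is the outward unit
normal. -/
theorem isOutwardUnitNormal_outwardNormal {d : ℕ} {Ω : Set (EuclideanSpace ℝ (Fin d))}
    (ho : IsOpen Ω) (hΩ : HasC1Boundary Ω) {p : EuclideanSpace ℝ (Fin d)}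
    (hp : p ∈ frontier Ω) : IsOutwardUnitNormal Ω p (outwardNormal Ω p) := by
  suffices h : ∃ n, IsOutwardUnitNormal Ω p n by
    unfold outwardNormal
    rw [dif_pos h]
    exact h.choose_spec
  obtain ⟨e, he, γ, hγ, r, hr, hloc⟩ := hΩ p hp
  set P := (Submodule.span ℝ {e})ᗮ.orthogonalProjectionOnto with hP
  set G : EuclideanSpace ℝ (Fin d) → ℝ := fun x => ⟪e, x⟫_ℝ - γ (P x) with hG
  have hdiff : Differentiable ℝ G := by
    have h1 : Differentiable ℝ fun x => ⟪e, x⟫_ℝ := (innerSL ℝ e).differentiable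
    exact h1.sub ((hγ.differentiable one_ne_zero).comp P.differentiable)
  have hmem : ∀ x ∈ ball p r, (x ∈ Ω ↔ G x < 0) := fun x hx => by
    rw [hloc x hx]; simp [hG]
  have hball : ball p r ∈ 𝓝 p := ball_mem_nhds p hr
  have hGp : G p = 0 := by
    apply le_antisymm
    · by_contra! hlt
      have hev : ∀ᶠ x in 𝓝 p, x ∉ Ω := by
        filter_upwards [hball, (hdiff.continuous.tendsto p).eventually (lt_mem_nhds hlt)]
          with x hx hx2
        rw [hmem x hx]
        exact not_lt.2 hx2.le
      obtain ⟨x, hx1, hx2⟩ := mem_closure_iff_frequently.1 (frontier_subset_closure hp)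
        |>.and_eventually hev |>.exists
      exact hx2 hx1
    · by_contra! hlt
      have : p ∈ Ω := (hmem p (mem_ball_self hr)).2 hlt
      rw [ho.frontier_eq] at hp
      exact hp.2 this
  set L := fderiv ℝ G p with hL
  set g := (InnerProductSpace.toDual ℝ (EuclideanSpace ℝ (Fin d))).symm L with hg
  have hgL : ∀ w, ⟪g, w⟫_ℝ = L w := fun w => by
    rw [hg, InnerProductSpace.toDual_symm_apply]
  have hline : ∀ w, HasDerivAt (fun t : ℝ => G (p + t • w)) (L w) 0 := fun w => by
    have h1 : HasFDerivAt G L (p + (0 : ℝ) • w) := by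
      simpa using (hdiff p).hasFDerivAt
    have h2 : HasDerivAt (fun t : ℝ => p + t • w) w 0 := by
      simpa using ((hasDerivAt_id (0 : ℝ)).smul_const w).const_add p
    exact h1.comp_hasDerivAt (0 : ℝ) h2
  have hLe : L e = 1 := by
    have hPe : P e = 0 := by
      rw [hP, Submodule.orthogonalProjectionOnto_eq_zero_iff, Submodule.orthogonal_orthogonal]
      exact Submodule.mem_span_singleton_self e
    have h1 : (fun t : ℝ => G (p + t • e)) = fun t : ℝ => G p + t := by
      funext t
      simp only [hG, map_add, map_smul, hPe, smul_zero, add_zero, inner_add_right,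
        inner_smul_right, real_inner_self_eq_norm_sq, he]
      ring
    have h2 := hline e
    rw [h1] at h2
    exact h2.unique ((hasDerivAt_id (0 : ℝ)).const_add (G p))
  have hg0 : g ≠ 0 := by
    intro h0
    have := hgL e
    rw [h0, inner_zero_left, hLe] at this
    exact zero_ne_one this
  have hgn : 0 < ‖g‖⁻¹ := inv_pos.2 (norm_pos_iff.2 hg0)
  have hnear : ∀ w, ∀ᶠ t : ℝ in 𝓝[>] 0, p + t • w ∈ ball p r := fun w => by
    have hc : Tendsto (fun t : ℝ => p + t • w) (𝓝 0) (𝓝 p) := by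
      have : Continuous fun t : ℝ => p + t • w := by fun_prop
      simpa using this.tendsto 0
    exact (hc.eventually hball).filter_mono nhdsWithin_le_nhds
  have hslope : ∀ w, Tendsto (fun t : ℝ => t⁻¹ * G (p + t • w)) (𝓝[>] 0) (𝓝 (L w)) := fun w => by
    have := (hline w).tendsto_slope_zero_right
    simpa [hGp] using this
  refine ⟨‖g‖⁻¹ • g, ?_, fun w => ⟨fun hw => ?_, fun hw => ?_⟩⟩
  · rw [norm_smul, norm_inv, norm_norm, inv_mul_cancel₀ (norm_ne_zero_iff.2 hg0)]
  · rw [real_inner_smul_left, hgL] at hw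
    have hw' : L w < 0 := by
      by_contra! h
      exact absurd hw (not_lt.2 (mul_nonneg hgn.le h))
    filter_upwards [hnear w, (hslope w).eventually (gt_mem_nhds hw'), self_mem_nhdsWithin]
      with t h1 h2 h3
    rw [hmem _ h1]
    have h3' : (0 : ℝ) < t⁻¹ := inv_pos.2 h3
    by_contra! h
    exact absurd h2 (not_lt.2 (mul_nonneg h3'.le h))
  · rw [real_inner_smul_left, hgL] at hw
    have hw' : 0 < L w := pos_of_mul_pos_right hw hgn.le
    filter_upwards [hnear w, (hslope w).eventually (lt_mem_nhds hw'), self_mem_nhdsWithin]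
      with t h1 h2 h3
    rw [hmem _ h1]
    have h3' : (0 : ℝ) < t⁻¹ := inv_pos.2 h3
    exact not_lt.2 (pos_of_mul_pos_right h2 h3'.le).le

/-! ### Green function of the Helmholtz equation -/

/-- The Bessel function `J₀` of the first kind of order zero. -/
def besselJ0 (t : ℝ) : ℝ :=
  ∑' m : ℕ, (-1) ^ m / ((m ! : ℕ) : ℝ) ^ 2 * (t / 2) ^ (2 * m)

/-- The Bessel function `Y₀` of the second kind of order zero (for `t > 0`). -/
def besselY0 (t : ℝ) : ℝ :=
  2 / Real.pi * (Real.log (t / 2) + Real.eulerMascheroniConstant) * besselJ0 t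
    - 2 / Real.pi *
      ∑' m : ℕ, (-1) ^ m * ((harmonic m : ℚ) : ℝ) / ((m ! : ℕ) : ℝ) ^ 2 * (t / 2) ^ (2 * m)

/-- The Hankel function `H₀⁽¹⁾ = J₀ + i Y₀` of the first kind of order zero (for `t > 0`). -/
def hankelH10 (t : ℝ) : ℂ :=
  (besselJ0 t : ℂ) + Complex.I * (besselY0 t : ℂ)

/-- The radiating Green function `Φ(x,y)`, `x ≠ y`, of the Helmholtz equation with wavenumber `k`
in dimension `d = 2` (first case) and `d = 3` (second case). -/
def greenΦ {d : ℕ} (k : ℝ) (x y : EuclideanSpace ℝ (Fin d)) : ℂ :=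
  if d = 2 then
    Complex.I / 4 * hankelH10 (k * ‖x - y‖)
  else
    Complex.exp (Complex.I * ((k * ‖x - y‖ : ℝ) : ℂ)) / ((4 * Real.pi * ‖x - y‖ : ℝ) : ℂ)

/-- `Im Φ(x,y)`: the imaginary part of the Green function, extended to the diagonal `x = y`, where
`Φ` is singular, by its limit there. -/
def imΦ {d : ℕ} (k : ℝ) (x y : EuclideanSpace ℝ (Fin d)) : ℝ :=
  if x = y then (if d = 2 then 1 / 4 else k / (4 * Real.pi)) else (greenΦ k x y).im

/-- The closed form of `Im Φ`. -/
theorem imΦ_eq {d : ℕ} {k : ℝ} (hk : k ≠ 0) (x y : EuclideanSpace ℝ (Fin d)) :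
    imΦ k x y = if d = 2 then 1 / 4 * besselJ0 (k * ‖x - y‖)
      else k / (4 * Real.pi) * Real.sinc (k * ‖x - y‖) := by
  have h0 : besselJ0 0 = 1 := by
    unfold besselJ0
    rw [tsum_eq_single 0 (fun m hm => by simp [hm])]
    simp
  unfold imΦ greenΦ
  by_cases hxy : x = y
  · subst hxy
    simp [h0]
  · rw [if_neg hxy]
    split_ifs with hd
    · have : Complex.I / 4 * hankelH10 (k * ‖x - y‖)
          = ((-(1 / 4) * besselY0 (k * ‖x - y‖) : ℝ) : ℂ)
            + ((1 / 4 * besselJ0 (k * ‖x - y‖) : ℝ) : ℂ) * Complex.I := by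
        unfold hankelH10
        push_cast
        linear_combination (besselY0 (k * ‖x - y‖) : ℂ) / 4 * Complex.I_mul_I
      rw [this]
      simp
    · have hn : ‖x - y‖ ≠ 0 := norm_ne_zero_iff.2 (sub_ne_zero.2 hxy)
      rw [mul_comm Complex.I, Complex.div_ofReal_im, Complex.exp_ofReal_mul_I_im,
        Real.sinc_of_ne_zero (mul_ne_zero hk hn)]
      have := Real.pi_ne_zero
      field_simp

/-- `Im Φ(·,y)`, including its value at `y`, is continuous. -/
theorem continuous_imΦ {d : ℕ} {k : ℝ} (hk : k ≠ 0) (y : EuclideanSpace ℝ (Fin d)) :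
    Continuous fun x => imΦ k x y := by
  have hJ : Continuous besselJ0 := by
    rw [continuous_iff_continuousAt]
    intro t₀
    have hon : ContinuousOn besselJ0 (ball 0 (|t₀| + 1)) := by
      unfold besselJ0
      refine continuousOn_tsum (u := fun m : ℕ => (((|t₀| + 1) / 2) ^ 2) ^ m / (m ! : ℝ))
        (fun m => by fun_prop) (Real.summable_pow_div_factorial _) (fun m t ht => ?_)
      have ht' : |t| ≤ |t₀| + 1 := by
        rw [mem_ball_zero_iff, Real.norm_eq_abs] at ht
        exact ht.le
      have hf : (1 : ℝ) ≤ (m ! : ℝ) := by exact_mod_cast Nat.succ_le_of_lt (Nat.factorial_pos m)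
      rw [norm_mul, norm_div, norm_pow, norm_neg, norm_one, one_pow, norm_pow, norm_pow,
        Real.norm_natCast, Real.norm_eq_abs, abs_div, abs_two, pow_mul, div_mul_eq_mul_div, one_mul]
      gcongr
      nlinarith
    exact hon.continuousAt (isOpen_ball.mem_nhds (by
      rw [mem_ball_zero_iff, Real.norm_eq_abs]; linarith))
  simp only [imΦ_eq hk]
  split_ifs
  · fun_prop
  · have := Real.continuous_sinc
    fun_prop

/-- The field `u = ∑ⱼ αⱼ Φ(·,xⱼ)` radiated by the point sources at `xⱼ` with intensities `αⱼ`. -/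
def radiatedField {d N : ℕ} (k : ℝ) (α : Fin N → ℂ) (x : Fin N → EuclideanSpace ℝ (Fin d))
    (y : EuclideanSpace ℝ (Fin d)) : ℂ :=
  ∑ j, α j * greenΦ k y (x j)

end InverseSource

end

/-! Put v = Im Φ(·,z). It solves Δv + k²v = 0 on the whole space, with no singularity even at z,
whereas w = Φ(·,xⱼ) solves Δw + k²w = -δ at xⱼ. Green's second identity turns the boundary integral
of (∂v/∂ν) w - v ∂w/∂ν into the pairing of v with δ, that is v(xⱼ), and linearity in the sources
gives the sum.

The singularity is regularized rather than excised. Both kernels are functions of s = |x - y|², and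
if g is the profile of Φ, then x ↦ g(|x - xⱼ|² + ε²) has no singularity. The Laplacian of this
function carries the factor |x - xⱼ|² where the radial equation for g carries |x - xⱼ|² + ε², so the
function solves Helmholtz up to the source -4ε² g''(|x - xⱼ|² + ε²)
(`integral_boundaryIntegrand_of_pos`). As ε → 0 the functions 4ε² g'' concentrate to a Dirac mass
(`IsFundamentalProfile.tendsto_setIntegral`), while the boundary integral converges to the one with
ε = 0 because xⱼ is not on ∂Ω. The dimension enters only through explicit profiles for d = 2 and d =
3, whose leading singularity fixes the mass 1.

Green's identity rests on the divergence theorem for C¹ domains and Hausdorff surface measure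
(`IsRegularBoundedDomain.setIntegral_fderiv`). Below a graph, a volume-preserving shear reduces it
to a half-space; the area formula `comap_euclideanHausdorffMeasure_eq_withDensity` identifies the
resulting integral with a surface integral; cutoffs pass from charts to Ω. -/

noncomputable section

set_option linter.unusedSectionVars false

namespace InverseSource

/-! ### The divergence theorem below a `C¹` graph -/

section HalfSpace

variable {U F : Type*} [NormedAddCommGroup U] [InnerProductSpace ℝ U] [FiniteDimensional ℝ U]
  [MeasurableSpace U] [BorelSpace U] [NormedAddCommGroup F] [NormedSpace ℝ F]

/-- The integral of a directional derivative of a compactly supported function vanishes. -/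
theorem integral_fderiv_apply_eq_zero {g : U → F} (hg : ContDiff ℝ 1 g)
    (hc : HasCompactSupport g) (u : U) : ∫ x, fderiv ℝ g x u = 0 := by
  have h := integral_smul_fderiv_eq_neg_fderiv_smul_of_integrable (μ := (volume : Measure U))
    (f := fun _ : U => (1 : ℝ)) (g := g) (v := u) (by simp)
    (by
      simp only [one_smul]
      exact ((hg.continuous_fderiv one_ne_zero).clm_apply continuous_const).integrable_of_hasCompactSupport
        (hc.fderiv_apply (𝕜 := ℝ) u))
    (by simpa using hg.continuous.integrable_of_hasCompactSupport hc)
    (fun x _ => differentiableAt_const _) (fun x _ => hg.differentiable one_ne_zero x)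
  simpa using h

theorem hasCompactSupport_comp_prodMk_left {X Y : Type*} [TopologicalSpace X] [TopologicalSpace Y]
    [T2Space X] [T2Space Y]
    {M : Type*} [Zero M] {g : X × Y → M} (hc : HasCompactSupport g) (x : X) :
    HasCompactSupport fun y => g (x, y) :=
  HasCompactSupport.intro (hc.isCompact.image continuous_snd) fun y hy => by
    by_contra h
    exact hy ⟨(x, y), subset_tsupport _ h, rfl⟩

theorem hasCompactSupport_comp_prodMk_right {X Y : Type*} [TopologicalSpace X]
    [TopologicalSpace Y] [T2Space X] [T2Space Y]
    {M : Type*} [Zero M] {g : X × Y → M} (hc : HasCompactSupport g) (y : Y) :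
    HasCompactSupport fun x => g (x, y) :=
  HasCompactSupport.intro (hc.isCompact.image continuous_fst) fun x hx => by
    by_contra h
    exact hx ⟨(x, y), subset_tsupport _ h, rfl⟩

/-- The divergence theorem in a half-space. -/
theorem setIntegral_halfSpace_fderiv [CompleteSpace F] {g : U × ℝ → F} (hg : ContDiff ℝ 1 g)
    (hc : HasCompactSupport g) {c : U → ℝ} (hcont : Continuous c) (u : U) :
    ∫ p in (univ : Set U) ×ˢ Iio (0 : ℝ), fderiv ℝ g p (u, c p.1)
      = ∫ x, c x • g (x, 0) := by
  have hg' : Continuous (fderiv ℝ g) := hg.continuous_fderiv one_ne_zero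
  have hi1 : Integrable (fun p => fderiv ℝ g p (u, 0)) (volume.prod volume) :=
    (hg'.clm_apply continuous_const).integrable_of_hasCompactSupport (hc.fderiv_apply (𝕜 := ℝ) _)
  have hi2 : Integrable (fun p : U × ℝ => c p.1 • fderiv ℝ g p (0, 1)) (volume.prod volume) :=
    ((hcont.comp continuous_fst).smul (hg'.clm_apply continuous_const)).integrable_of_hasCompactSupport
      ((hc.fderiv_apply (𝕜 := ℝ) _).smul_left)
  -- The tangential part integrates to zero on every slice t = const. In the vertical part the
  -- weight `c` does not depend on t, so the fundamental theorem of calculus applies on each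
  -- vertical half-line.
  have hsplit : ∀ p : U × ℝ, fderiv ℝ g p (u, c p.1)
      = fderiv ℝ g p (u, 0) + c p.1 • fderiv ℝ g p (0, 1) := fun p => by
    rw [← map_smul, ← map_add]; simp
  have hgd : Differentiable ℝ g := hg.differentiable one_ne_zero
  simp_rw [hsplit]
  rw [Measure.volume_eq_prod, integral_add hi1.integrableOn hi2.integrableOn]
  have h1 : ∫ p in (univ : Set U) ×ˢ Iio (0 : ℝ), fderiv ℝ g p (u, 0) ∂(volume.prod volume) = 0 := by
    rw [← Measure.prod_restrict, Measure.restrict_univ, integral_prod_symm]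
    · refine integral_eq_zero_of_ae (ae_of_all _ fun t => ?_)
      have hgt : ContDiff ℝ 1 fun x : U => g (x, t) := hg.comp (contDiff_prodMk_left t)
      have := integral_fderiv_apply_eq_zero hgt (hasCompactSupport_comp_prodMk_right hc t) u
      simp only [Pi.zero_apply]
      rw [← this]
      congr 1 with x
      have hd : HasFDerivAt (fun x : U => g (x, t))
          ((fderiv ℝ g (x, t)).comp (ContinuousLinearMap.inl ℝ U ℝ)) x :=
        (hgd (x, t)).hasFDerivAt.comp x (hasFDerivAt_prodMk_left x t)
      rw [hd.fderiv]
      simp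
    · rw [← Measure.restrict_univ (μ := (volume : Measure U)), Measure.prod_restrict]
      exact hi1.integrableOn
  have h2 : ∫ p in (univ : Set U) ×ˢ Iio (0 : ℝ), c p.1 • fderiv ℝ g p (0, 1) ∂(volume.prod volume)
      = ∫ x, c x • g (x, 0) := by
    rw [← Measure.prod_restrict, Measure.restrict_univ, integral_prod]
    · congr 1 with x
      simp only
      rw [integral_smul, ← integral_Iic_eq_integral_Iio]
      congr 1
      have hgx : ContDiff ℝ 1 fun t : ℝ => g (x, t) := hg.comp (contDiff_prodMk_right x)
      rw [← HasCompactSupport.integral_Iic_deriv_eq hgx (hasCompactSupport_comp_prodMk_left hc x) 0]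
      congr 1 with t
      have hd : HasFDerivAt (fun t : ℝ => g (x, t))
          ((fderiv ℝ g (x, t)).comp (ContinuousLinearMap.inr ℝ U ℝ)) t :=
        (hgd (x, t)).hasFDerivAt.comp t (hasFDerivAt_prodMk_right x t)
      rw [← fderiv_apply_one_eq_deriv, hd.fderiv]
      simp
    · rw [← Measure.restrict_univ (μ := (volume : Measure U)), Measure.prod_restrict]
      exact hi2.integrableOn
  rw [h1, h2, zero_add]

end HalfSpace

/-! ### Straightening a graph by a shear -/

section Graph

variable {E F : Type*} [NormedAddCommGroup E] [InnerProductSpace ℝ E] [FiniteDimensional ℝ E]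
  [MeasurableSpace E] [BorelSpace E] [NormedAddCommGroup F] [NormedSpace ℝ F]

/-- The parametrization of the graph of `γ` in the direction `e`. -/
def graphMap (e : E) (γ : (Submodule.span ℝ {e})ᗮ → ℝ) (x : (Submodule.span ℝ {e})ᗮ) : E :=
  x + γ x • e

/-- The shear taking the half-space below the hyperplane `e^⊥` to the region below the graph
of `γ`. -/
def graphShear (e : E) (γ : (Submodule.span ℝ {e})ᗮ → ℝ) (p : (Submodule.span ℝ {e})ᗮ × ℝ) : E :=
  p.1 + (p.2 + γ p.1) • e

variable {e : E} {γ : (Submodule.span ℝ {e})ᗮ → ℝ}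

theorem inner_coe_orthogonal_span (x : (Submodule.span ℝ {e})ᗮ) : ⟪e, (x : E)⟫_ℝ = 0 :=
  Submodule.mem_orthogonal_singleton_iff_inner_right.1 x.2

theorem projection_self : (Submodule.span ℝ {e})ᗮ.orthogonalProjectionOnto e = 0 := by
  rw [Submodule.orthogonalProjectionOnto_eq_zero_iff, Submodule.orthogonal_orthogonal]
  exact Submodule.mem_span_singleton_self e

theorem projection_coe_add_smul (x : (Submodule.span ℝ {e})ᗮ) (t : ℝ) :
    (Submodule.span ℝ {e})ᗮ.orthogonalProjectionOnto ((x : E) + t • e) = x := by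
  rw [map_add, map_smul, projection_self, smul_zero, add_zero,
    Submodule.orthogonalProjectionOnto_mem_subspace_eq_self]

theorem inner_coe_add_smul (he : ‖e‖ = 1) (x : (Submodule.span ℝ {e})ᗮ) (t : ℝ) :
    ⟪e, (x : E) + t • e⟫_ℝ = t := by
  rw [inner_add_right, inner_coe_orthogonal_span, inner_smul_right, real_inner_self_eq_norm_sq, he]
  ring

theorem projection_add_inner_smul (he : ‖e‖ = 1) (y : E) :
    ((Submodule.span ℝ {e})ᗮ.orthogonalProjectionOnto y : E) + ⟪e, y⟫_ℝ • e = y := by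
  have h1 := Submodule.starProjection_add_starProjection_orthogonal (K := Submodule.span ℝ {e}) y
  rw [Submodule.starProjection_unit_singleton ℝ he] at h1
  rw [add_comm]
  exact h1

/-- The shear as a homeomorphism. -/
def graphShearHomeomorph (he : ‖e‖ = 1) (hγ : Continuous γ) :
    (Submodule.span ℝ {e})ᗮ × ℝ ≃ₜ E where
  toFun := graphShear e γ
  invFun y := ((Submodule.span ℝ {e})ᗮ.orthogonalProjectionOnto y,
    ⟪e, y⟫_ℝ - γ ((Submodule.span ℝ {e})ᗮ.orthogonalProjectionOnto y))
  left_inv p := by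
    simp only [graphShear]
    rw [projection_coe_add_smul, inner_coe_add_smul he, add_sub_cancel_right]
  right_inv y := by
    simp only [graphShear]
    rw [sub_add_cancel, projection_add_inner_smul he]
  continuous_toFun := by unfold graphShear; fun_prop
  continuous_invFun := by fun_prop

/-- The shear translates each vertical line by γ(x), which preserves the product measure; e^⊥ × ℝ is
then identified isometrically with the ambient space. -/
theorem measurePreserving_graphShear (he : ‖e‖ = 1) (hγ : Continuous γ) :
    MeasurePreserving (graphShear e γ) (volume.prod volume) volume := by
  have h1 : MeasurePreserving (fun p : (Submodule.span ℝ {e})ᗮ × ℝ => (p.1, p.2 + γ p.1))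
      (volume.prod volume) (volume.prod volume) :=
    (MeasurePreserving.id _).skew_product (g := fun x t => t + γ x)
      (by unfold Function.uncurry; fun_prop)
      (ae_of_all _ fun x => (measurePreserving_add_right volume (γ x)).map_eq)
  have h2 : MeasurePreserving (fun p : (Submodule.span ℝ {e})ᗮ × ℝ =>
      ((LinearIsometryEquiv.toSpanUnitSingleton (𝕜 := ℝ) e he p.2), p.1))
      (volume.prod volume) (volume.prod volume) :=
    Measure.measurePreserving_swap.comp
      ((MeasurePreserving.id _).prod (LinearIsometryEquiv.measurePreserving _))
  have h3 := ((Submodule.span ℝ {e}).measurePreserving_measurableEquivProd (0 : E)).symm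
  rw [InnerProductSpace.euclideanHausdorffMeasure_eq_volume] at h3
  have h := h3.comp (h2.comp h1)
  convert! h using 1
  ext p
  simp [graphShear, add_comm]

theorem contDiff_graphShear (hγ : ContDiff ℝ 1 γ) : ContDiff ℝ 1 (graphShear e γ) := by
  unfold graphShear
  have h1 : ContDiff ℝ 1 fun p : (Submodule.span ℝ {e})ᗮ × ℝ => (p.1 : E) :=
    (Submodule.span ℝ {e})ᗮ.subtypeL.contDiff.comp contDiff_fst
  exact h1.add ((contDiff_snd.add (hγ.comp contDiff_fst)).smul contDiff_const)

theorem hasFDerivAt_graphShear (hγ : ContDiff ℝ 1 γ) (p : (Submodule.span ℝ {e})ᗮ × ℝ)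
    (u : (Submodule.span ℝ {e})ᗮ) (t : ℝ) :
    fderiv ℝ (graphShear e γ) p (u, t) = (u : E) + (t + fderiv ℝ γ p.1 u) • e := by
  have h1 : HasFDerivAt (fun p : (Submodule.span ℝ {e})ᗮ × ℝ => (p.1 : E))
      ((Submodule.span ℝ {e})ᗮ.subtypeL.comp (ContinuousLinearMap.fst ℝ _ ℝ)) p :=
    ((Submodule.span ℝ {e})ᗮ.subtypeL.hasFDerivAt).comp p hasFDerivAt_fst
  have h2 : HasFDerivAt (fun p : (Submodule.span ℝ {e})ᗮ × ℝ => γ p.1)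
      ((fderiv ℝ γ p.1).comp (ContinuousLinearMap.fst ℝ _ ℝ)) p :=
    ((hγ.differentiable one_ne_zero) p.1).hasFDerivAt.comp p hasFDerivAt_fst
  have h3 := h1.add ((hasFDerivAt_snd.add h2).smul_const e)
  have h4 : HasFDerivAt (graphShear e γ) _ p := h3
  rw [h4.fderiv]
  simp

/-- The divergence theorem in the region below a `C¹` graph. -/
theorem setIntegral_subgraph_fderiv [CompleteSpace F] (he : ‖e‖ = 1) (hγ : ContDiff ℝ 1 γ)
    {f : E → F} (hf : ContDiff ℝ 1 f) (hc : HasCompactSupport f) (w : E) :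
    ∫ y in {y | ⟪e, y⟫_ℝ < γ ((Submodule.span ℝ {e})ᗮ.orthogonalProjectionOnto y)},
        fderiv ℝ f y w
      = ∫ x, (⟪e, w⟫_ℝ - fderiv ℝ γ x ((Submodule.span ℝ {e})ᗮ.orthogonalProjectionOnto w))
          • f (graphMap e γ x) := by
  set P := (Submodule.span ℝ {e})ᗮ.orthogonalProjectionOnto with hP
  have hΨ := measurePreserving_graphShear he hγ.continuous
  set H := graphShearHomeomorph he hγ.continuous with hH
  have hHΨ : ⇑H = graphShear e γ := rfl
  rw [← hΨ.setIntegral_preimage_emb (hHΨ ▸ H.measurableEmbedding)]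
  have hpre : graphShear e γ ⁻¹' {y | ⟪e, y⟫_ℝ < γ (P y)} = (univ : Set _) ×ˢ Iio (0 : ℝ) := by
    ext p
    simp only [graphShear, mem_preimage, mem_ofPred_eq, mem_prod, mem_univ, true_and, mem_Iio]
    rw [inner_coe_add_smul he, projection_coe_add_smul]
    constructor <;> intro h <;> linarith
  rw [hpre]
  have hg : ContDiff ℝ 1 (f ∘ graphShear e γ) := hf.comp (contDiff_graphShear hγ)
  have hgc : HasCompactSupport (f ∘ graphShear e γ) := hc.comp_homeomorph H
  have hcont : Continuous fun x => ⟪e, w⟫_ℝ - fderiv ℝ γ x (P w) :=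
    continuous_const.sub ((hγ.continuous_fderiv one_ne_zero).clm_apply continuous_const)
  -- The derivative of the shear sends (P w, ⟪e, w⟫ - dγ(P w)) to P w + ⟪e, w⟫ e = w. The fixed
  -- direction w thus becomes one whose vertical component depends on the base point alone, which is
  -- why the half-space version allows a variable `c`.
  have key := setIntegral_halfSpace_fderiv hg hgc hcont (P w)
  rw [Measure.volume_eq_prod] at key
  convert key using 1
  · congr 1 with p
    rw [fderiv_comp p (hf.differentiable one_ne_zero _)
      ((contDiff_graphShear hγ).differentiable one_ne_zero p), ContinuousLinearMap.comp_apply,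
      hasFDerivAt_graphShear hγ, sub_add_cancel, projection_add_inner_smul he]
  · congr 1 with x
    simp [graphShear, graphMap]

end Graph

/-! ### The area formula for the Hausdorff measure -/

section Area

open scoped NNReal ENNReal

/-- The hypothesis forces f to factor through g on s by a K-Lipschitz map, even when g is not
injective. Comparing two maps, rather than a map with the identity, lets f and its linearization be
compared in both directions. -/
theorem euclideanHausdorffMeasure_image_le_of_dist_le {X Y Z : Type*} [MetricSpace Y]
    [MeasurableSpace Y] [BorelSpace Y] [MetricSpace Z] [MeasurableSpace Z] [BorelSpace Z]
    (n : ℕ) {s : Set X} {f : X → Y} {g : X → Z} {K : ℝ≥0}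
    (h : ∀ x ∈ s, ∀ y ∈ s, dist (f x) (f y) ≤ K * dist (g x) (g y)) :
    μHE[n] (f '' s) ≤ (K : ℝ≥0∞) ^ n * μHE[n] (g '' s) := by
  classical
  rcases s.eq_empty_or_nonempty with rfl | ⟨x₀, hx₀⟩
  · simp
  have : Nonempty X := ⟨x₀⟩
  have hinv : ∀ x ∈ s, f (Function.invFunOn g s (g x)) = f x := fun x hx => by
    have h1 : Function.invFunOn g s (g x) ∈ s := Function.invFunOn_mem ⟨x, hx, rfl⟩
    have h2 : g (Function.invFunOn g s (g x)) = g x := Function.invFunOn_eq ⟨x, hx, rfl⟩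
    have h3 := h _ h1 x hx
    rw [h2, dist_self, mul_zero] at h3
    exact dist_le_zero.1 h3
  have hL : LipschitzOnWith K (f ∘ Function.invFunOn g s) (g '' s) := by
    refine LipschitzOnWith.of_dist_le_mul ?_
    rintro _ ⟨x, hx, rfl⟩ _ ⟨y, hy, rfl⟩
    rw [Function.comp_apply, Function.comp_apply, hinv x hx, hinv y hy]
    exact h x hx y hy
  have himg : (f ∘ Function.invFunOn g s) '' (g '' s) = f '' s := by
    rw [image_image]
    exact image_congr fun x hx => hinv x hx
  have := hL.hausdorffMeasure_image_le (d := n) (by positivity)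
  rw [himg, ENNReal.rpow_natCast] at this
  rw [Measure.euclideanHausdorffMeasure_def, Measure.euclideanHausdorffMeasure_def,
    Measure.smul_apply, Measure.smul_apply, ENNReal.smul_def, ENNReal.smul_def, smul_eq_mul,
    smul_eq_mul, mul_left_comm]
  gcongr

variable {U E : Type*} [NormedAddCommGroup U] [InnerProductSpace ℝ U] [FiniteDimensional ℝ U]
  [MeasurableSpace U] [BorelSpace U] [NormedAddCommGroup E] [InnerProductSpace ℝ E]
  [MeasurableSpace E] [BorelSpace E]

/-- Strict differentiability bounds the error by δ‖a - b‖, and ‖a - b‖ ≤ ‖L (a - b)‖ makes this a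
relative error with respect to L. -/
theorem eventually_dist_le_of_hasStrictFDerivAt {f : U → E} {L : U →L[ℝ] E} {x : U}
    (hf : HasStrictFDerivAt f L x) (hL : ∀ v, ‖v‖ ≤ ‖L v‖) {K : ℝ≥0} (hK : 1 < K) :
    ∀ᶠ r in 𝓝[>] (0 : ℝ), ∀ a ∈ closedBall x r, ∀ b ∈ closedBall x r,
      dist (f a) (f b) ≤ K * dist (L a) (L b) ∧ dist (L a) (L b) ≤ K * dist (f a) (f b) := by
  have hK' : (1 : ℝ) < K := by exact_mod_cast hK
  have hK0 : (0 : ℝ) < K := by linarith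
  -- Chosen so that 1 - δ = 1/K exactly; then 1 + δ = 2 - 1/K ≤ K as well.
  set δ : ℝ := 1 - (K : ℝ)⁻¹ with hδ
  have hδ0 : 0 < δ := by
    have := inv_lt_one_of_one_lt₀ hK'
    linarith
  have hlo := (hasStrictFDerivAt_iff_isLittleO.1 hf).def hδ0
  obtain ⟨ε, hε, hball⟩ := Metric.eventually_nhds_iff.1 hlo
  filter_upwards [Ioo_mem_nhdsGT hε] with r hr a ha b hb
  have hab : dist (a, b) (x, x) < ε :=
    (max_le (mem_closedBall.1 ha) (mem_closedBall.1 hb)).trans_lt hr.2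
  have h1 := hball hab
  simp only at h1
  have h2 : ‖f a - f b - L (a - b)‖ ≤ δ * ‖L (a - b)‖ :=
    h1.trans (mul_le_mul_of_nonneg_left (hL _) hδ0.le)
  rw [dist_eq_norm, dist_eq_norm, ← map_sub]
  have h3 : ‖f a - f b‖ ≤ ‖f a - f b - L (a - b)‖ + ‖L (a - b)‖ := by
    simpa using norm_add_le (f a - f b - L (a - b)) (L (a - b))
  have h4 : ‖L (a - b)‖ ≤ ‖f a - f b - L (a - b)‖ + ‖f a - f b‖ := by
    have := norm_sub_le (f a - f b) (f a - f b - L (a - b))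
    rw [sub_sub_cancel] at this
    linarith
  have hKK : (K : ℝ) * (K : ℝ)⁻¹ = 1 := mul_inv_cancel₀ hK0.ne'
  have hn := norm_nonneg (L (a - b))
  constructor
  · have h5 : 1 + δ ≤ K := by
      have : (0 : ℝ) ≤ (K : ℝ)⁻¹ := by positivity
      nlinarith [sq_nonneg ((K : ℝ) - 1)]
    nlinarith
  · have h5 : (K : ℝ)⁻¹ * ‖L (a - b)‖ ≤ ‖f a - f b‖ := by rw [hδ] at h2; linarith
    have h6 := mul_le_mul_of_nonneg_left h5 hK0.le
    rwa [← mul_assoc, hKK, one_mul] at h6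

theorem eq_of_forall_le_pow_mul {a b : ℝ≥0∞} (n : ℕ)
    (h : ∀ K : ℝ≥0, 1 < K → a ≤ (K : ℝ≥0∞) ^ n * b) : a ≤ b := by
  have ht : Tendsto (fun K : ℝ≥0 => (K : ℝ≥0∞) ^ n * b) (𝓝[>] 1) (𝓝 (1 ^ n * b)) := by
    refine ENNReal.Tendsto.mul_const ?_ (Or.inl (by simp))
    refine ENNReal.Tendsto.pow ?_
    have : Tendsto (fun K : ℝ≥0 => (K : ℝ≥0∞)) (𝓝 1) (𝓝 ((1 : ℝ≥0) : ℝ≥0∞)) :=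
      ENNReal.continuous_coe.tendsto 1
    exact this.mono_left nhdsWithin_le_nhds
  rw [one_pow, one_mul] at ht
  exact ge_of_tendsto ht (eventually_mem_nhdsWithin.mono fun K hK => h K hK)

variable {f : U → E} {f' : U → U →L[ℝ] E}

/-- Strict differentiability makes f locally Lipschitz, so it multiplies measure by a locally
bounded factor. Local finiteness is needed for differentiating the pulled-back measure along balls.
-/
theorem isLocallyFiniteMeasure_comap_euclideanHausdorffMeasure
    (hemb : MeasurableEmbedding f) (hf : ∀ x, HasStrictFDerivAt f (f' x) x) :
    IsLocallyFiniteMeasure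
      ((μHE[Module.finrank ℝ U] : Measure E).comap f) := by
  refine ⟨fun x => ?_⟩
  obtain ⟨K, s, hs, hK⟩ := (hf x).exists_lipschitzOnWith
  refine ⟨s ∩ closedBall x 1, inter_mem hs (closedBall_mem_nhds x one_pos), ?_⟩
  rw [hemb.comap_apply]
  refine (euclideanHausdorffMeasure_image_le_of_dist_le _ (g := id) (K := K)
    fun a ha b hb => hK.dist_le_mul a ha.1 b hb.1).trans_lt ?_
  rw [image_id, InnerProductSpace.euclideanHausdorffMeasure_eq_volume]
  refine ENNReal.mul_lt_top (by finiteness) ?_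
  exact (measure_mono inter_subset_right).trans_lt measure_closedBall_lt_top

theorem comap_euclideanHausdorffMeasure_absolutelyContinuous
    (hemb : MeasurableEmbedding f) (hf : ∀ x, HasStrictFDerivAt f (f' x) x) :
    (μHE[Module.finrank ℝ U] : Measure E).comap f ≪ (volume : Measure U) := by
  intro A hA
  refine measure_null_of_locally_null A fun x _ => ?_
  obtain ⟨K, s, hs, hK⟩ := (hf x).exists_lipschitzOnWith
  refine ⟨A ∩ s, inter_mem_nhdsWithin A hs, ?_⟩
  rw [hemb.comap_apply, ← nonpos_iff_eq_zero]
  refine (euclideanHausdorffMeasure_image_le_of_dist_le _ (g := id) (K := K)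
    fun a ha b hb => hK.dist_le_mul a ha.2 b hb.2).trans ?_
  rw [image_id, InnerProductSpace.euclideanHausdorffMeasure_eq_volume,
    measure_mono_null inter_subset_left hA, mul_zero]

/-- The area formula for a differentiable embedding whose derivative does not decrease norms. -/
theorem comap_euclideanHausdorffMeasure_eq_withDensity
    (hemb : MeasurableEmbedding f) (hf : ∀ x, HasStrictFDerivAt f (f' x) x)
    (hf' : ∀ x v, ‖v‖ ≤ ‖f' x v‖) :
    (μHE[Module.finrank ℝ U] : Measure E).comap f
      = (volume : Measure U).withDensity
          fun x => ENNReal.ofReal (f' x : U →ₗ[ℝ] E).normDet := by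
  set ρ := (μHE[Module.finrank ℝ U] : Measure E).comap f with hρ
  have : IsLocallyFiniteMeasure ρ := isLocallyFiniteMeasure_comap_euclideanHausdorffMeasure hemb hf
  have hac : ρ ≪ (volume : Measure U) :=
    comap_euclideanHausdorffMeasure_absolutelyContinuous hemb hf
  rw [← Measure.withDensity_rnDeriv_eq _ _ hac]
  refine withDensity_congr_ae ?_
  -- The density is a.e. the limit of ratios of measures on shrinking balls. On a small ball f
  -- distorts distances by at most a factor K > 1 compared with its derivative, so the ratio lies
  -- between K^(-n) J and K^n J, where J is the exact ratio for the linear map; then K decreases to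
  -- 1.
  filter_upwards [Besicovitch.ae_tendsto_rnDeriv ρ (volume : Measure U)] with x hx
  set J := ENNReal.ofReal (f' x : U →ₗ[ℝ] E).normDet with hJ
  have hvol : ∀ᶠ r in 𝓝[>] (0 : ℝ), (volume (closedBall x r) ≠ 0 ∧ volume (closedBall x r) ≠ ⊤) := by
    filter_upwards [self_mem_nhdsWithin] with r hr
    exact ⟨(measure_closedBall_pos _ _ hr).ne', measure_closedBall_lt_top.ne⟩
  have himg : ∀ s : Set U, μHE[Module.finrank ℝ U] (f' x '' s) = J * volume s := fun s =>
    LinearMap.euclideanHausdorffMeasure_image_eq_normDet_mul_volume (f' x : U →ₗ[ℝ] E) s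
  apply le_antisymm
  · refine eq_of_forall_le_pow_mul (Module.finrank ℝ U) fun K hK => ?_
    refine le_of_tendsto hx ?_
    filter_upwards [hvol, eventually_dist_le_of_hasStrictFDerivAt (hf x) (hf' x) hK] with r hr h
    rw [ENNReal.div_le_iff hr.1 hr.2, hρ, hemb.comap_apply, mul_assoc, ← himg]
    exact euclideanHausdorffMeasure_image_le_of_dist_le _ fun a ha b hb => (h a ha b hb).1
  · refine eq_of_forall_le_pow_mul (Module.finrank ℝ U) fun K hK => ?_
    refine ge_of_tendsto (ENNReal.Tendsto.const_mul hx (Or.inr (by finiteness))) ?_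
    filter_upwards [hvol, eventually_dist_le_of_hasStrictFDerivAt (hf x) (hf' x) hK] with r hr h
    rw [← mul_div_assoc, ENNReal.le_div_iff_mul_le (Or.inl hr.1) (Or.inl hr.2), ← himg, hρ,
      hemb.comap_apply]
    exact euclideanHausdorffMeasure_image_le_of_dist_le _ fun a ha b hb => (h a ha b hb).2

end Area

/-! ### Hausdorff measure on a `C¹` graph -/

section Graph

variable {E F : Type*} [NormedAddCommGroup E] [InnerProductSpace ℝ E] [FiniteDimensional ℝ E]
  [MeasurableSpace E] [BorelSpace E] [NormedAddCommGroup F] [NormedSpace ℝ F]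
  {e : E} {γ : (Submodule.span ℝ {e})ᗮ → ℝ}

/-- A vector normal to the graph of `γ`, pointing in the direction `e`. -/
def graphNormal (e : E) (γ : (Submodule.span ℝ {e})ᗮ → ℝ) (x : (Submodule.span ℝ {e})ᗮ) : E :=
  e - ((gradient γ x : (Submodule.span ℝ {e})ᗮ) : E)

/-- The right-hand side is the weight produced by the shear in `setIntegral_subgraph_fderiv`; this
recognizes it as a normal component. -/
theorem inner_graphNormal (x : (Submodule.span ℝ {e})ᗮ) (w : E) :
    ⟪graphNormal e γ x, w⟫_ℝ
      = ⟪e, w⟫_ℝ - fderiv ℝ γ x ((Submodule.span ℝ {e})ᗮ.orthogonalProjectionOnto w) := by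
  rw [graphNormal, inner_sub_left, gradient,
    ← Submodule.inner_orthogonalProjectionOnto_eq_of_mem_left, InnerProductSpace.toDual_symm_apply]

theorem norm_graphNormal_sq (he : ‖e‖ = 1) (x : (Submodule.span ℝ {e})ᗮ) :
    ‖graphNormal e γ x‖ ^ 2 = 1 + ‖gradient γ x‖ ^ 2 := by
  rw [graphNormal, norm_sub_sq_real, inner_coe_orthogonal_span, he]
  simp

theorem norm_graphNormal_pos (he : ‖e‖ = 1) (x : (Submodule.span ℝ {e})ᗮ) :
    0 < ‖graphNormal e γ x‖ := by
  have := norm_graphNormal_sq (γ := γ) he x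
  by_contra! h
  have h0 : ‖graphNormal e γ x‖ = 0 := le_antisymm h (norm_nonneg _)
  rw [h0] at this
  nlinarith [sq_nonneg ‖gradient γ x‖]

theorem continuous_graphNormal (hγ : ContDiff ℝ 1 γ) : Continuous (graphNormal e γ) := by
  unfold graphNormal gradient
  have := hγ.continuous_fderiv one_ne_zero
  fun_prop

/-- The derivative of `graphMap`. -/
def graphMapDeriv (e : E) (γ : (Submodule.span ℝ {e})ᗮ → ℝ) (x : (Submodule.span ℝ {e})ᗮ) :
    (Submodule.span ℝ {e})ᗮ →L[ℝ] E :=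
  (Submodule.span ℝ {e})ᗮ.subtypeL + (fderiv ℝ γ x).smulRight e

theorem projection_graphMap (x : (Submodule.span ℝ {e})ᗮ) :
    (Submodule.span ℝ {e})ᗮ.orthogonalProjectionOnto (graphMap e γ x) = x :=
  projection_coe_add_smul _ _

theorem hasStrictFDerivAt_graphMap (hγ : ContDiff ℝ 1 γ) (x : (Submodule.span ℝ {e})ᗮ) :
    HasStrictFDerivAt (graphMap e γ) (graphMapDeriv e γ x) x :=
  ((Submodule.span ℝ {e})ᗮ.subtypeL.hasStrictFDerivAt).add
    ((hγ.contDiffAt.hasStrictFDerivAt one_ne_zero).smul_const e)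

/-- The orthogonal projection onto e^⊥ undoes the derivative and does not increase norms. This
supplies the hypothesis of the area formula. -/
theorem norm_le_norm_graphMapDeriv (x v : (Submodule.span ℝ {e})ᗮ) :
    ‖v‖ ≤ ‖graphMapDeriv e γ x v‖ := by
  have h : (Submodule.span ℝ {e})ᗮ.orthogonalProjectionOnto (graphMapDeriv e γ x v) = v :=
    projection_coe_add_smul _ _
  calc ‖v‖ = ‖(Submodule.span ℝ {e})ᗮ.orthogonalProjectionOnto (graphMapDeriv e γ x v)‖ := by rw [h]
    _ ≤ _ := Submodule.norm_orthogonalProjectionOnto_apply_le _ _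

theorem isClosedEmbedding_graphMap (hγ : Continuous γ) :
    IsClosedEmbedding (graphMap e γ) :=
  (Function.LeftInverse.isClosedEmbedding (f := (Submodule.span ℝ {e})ᗮ.orthogonalProjectionOnto)
    (fun x => projection_graphMap x) (by fun_prop) (by unfold graphMap; fun_prop))

theorem mem_range_graphMap (he : ‖e‖ = 1) {y : E} :
    y ∈ range (graphMap e γ)
      ↔ ⟪e, y⟫_ℝ = γ ((Submodule.span ℝ {e})ᗮ.orthogonalProjectionOnto y) := by
  constructor
  · rintro ⟨x, rfl⟩
    rw [projection_graphMap]
    exact inner_coe_add_smul he _ _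
  · intro h
    refine ⟨(Submodule.span ℝ {e})ᗮ.orthogonalProjectionOnto y, ?_⟩
    rw [graphMap, ← h, projection_add_inner_smul he]

/-- The Gram operator L*L is the identity plus the rank-one operator v ↦ dγ(v) ∇γ. Its determinant
is 1 + |∇γ|², the squared length of the graph normal. -/
theorem normDet_graphMapDeriv (he : ‖e‖ = 1) (x : (Submodule.span ℝ {e})ᗮ) :
    (graphMapDeriv e γ x : (Submodule.span ℝ {e})ᗮ →ₗ[ℝ] E).normDet = ‖graphNormal e γ x‖ := by
  have h := LinearMap.normDet_sq (graphMapDeriv e γ x : (Submodule.span ℝ {e})ᗮ →ₗ[ℝ] E)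
  have hcomp : (graphMapDeriv e γ x : (Submodule.span ℝ {e})ᗮ →ₗ[ℝ] E).adjoint ∘ₗ
      (graphMapDeriv e γ x : (Submodule.span ℝ {e})ᗮ →ₗ[ℝ] E)
      = LinearMap.transvection (fderiv ℝ γ x : (Submodule.span ℝ {e})ᗮ →ₗ[ℝ] ℝ)
          (gradient γ x) := by
    ext v : 1
    refine ext_inner_right ℝ fun w => ?_
    rw [LinearMap.comp_apply, LinearMap.adjoint_inner_left, LinearMap.transvection.apply,
      inner_add_left, inner_smul_left, gradient, InnerProductSpace.toDual_symm_apply]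
    simp [graphMapDeriv, inner_add_left, inner_add_right, inner_smul_left, inner_smul_right,
      inner_coe_orthogonal_span, real_inner_comm e, he, mul_comm]
  rw [hcomp, LinearMap.transvection.det] at h
  have h2 : fderiv ℝ γ x (gradient γ x) = ‖gradient γ x‖ ^ 2 := by
    rw [← real_inner_self_eq_norm_sq, gradient, InnerProductSpace.toDual_symm_apply]
  have h3 : (graphMapDeriv e γ x : (Submodule.span ℝ {e})ᗮ →ₗ[ℝ] E).normDet ^ 2
      = ‖graphNormal e γ x‖ ^ 2 := by
    rw [norm_graphNormal_sq he, ← h2]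
    exact h
  exact (pow_left_inj₀ (LinearMap.normDet_nonneg _) (norm_nonneg _) two_ne_zero).1 h3

theorem finrank_orthogonal_span (he : ‖e‖ = 1) :
    Module.finrank ℝ (Submodule.span ℝ {e})ᗮ = Module.finrank ℝ E - 1 := by
  have h := (Submodule.span ℝ {e}).finrank_add_finrank_orthogonal
  rw [finrank_span_singleton (by rintro rfl; simp at he)] at h
  omega

/-- Integration over the graph of a `C¹` function with respect to the Hausdorff measure. -/
theorem setIntegral_range_graphMap (he : ‖e‖ = 1) (hγ : ContDiff ℝ 1 γ) (h : E → F) :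
    ∫ y in range (graphMap e γ), h y ∂(μHE[Module.finrank ℝ E - 1])
      = ∫ x, ‖graphNormal e γ x‖ • h (graphMap e γ x) := by
  have hemb := (isClosedEmbedding_graphMap (e := e) hγ.continuous).measurableEmbedding
  have harea := comap_euclideanHausdorffMeasure_eq_withDensity hemb
    (hasStrictFDerivAt_graphMap hγ) norm_le_norm_graphMapDeriv
  rw [finrank_orthogonal_span he] at harea
  simp_rw [normDet_graphMapDeriv he] at harea
  rw [← hemb.map_comap, hemb.integral_map, harea,
    integral_withDensity_eq_integral_toReal_smul]
  · simp
  · exact (continuous_graphNormal hγ).norm.measurable.ennreal_ofReal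
  · simp

theorem measure_graphMap_image_lt_top (he : ‖e‖ = 1) (hγ : ContDiff ℝ 1 γ)
    {K : Set (Submodule.span ℝ {e})ᗮ} (hK : IsCompact K) :
    μHE[Module.finrank ℝ E - 1] (graphMap e γ '' K) < ⊤ := by
  have hemb := (isClosedEmbedding_graphMap (e := e) hγ.continuous).measurableEmbedding
  have := isLocallyFiniteMeasure_comap_euclideanHausdorffMeasure hemb
    (hasStrictFDerivAt_graphMap hγ)
  rw [← finrank_orthogonal_span he, ← hemb.comap_apply]
  exact hK.measure_lt_top

end Graph

/-! ### The divergence theorem in a regular bounded domain -/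

section Chart

variable {d : ℕ} {Ω : Set (EuclideanSpace ℝ (Fin d))} {p e : EuclideanSpace ℝ (Fin d)} {r : ℝ}
  {γ : (Submodule.span ℝ {e})ᗮ → ℝ}

/-- In the ball `B(p,r)`, the set `Ω` is the region below the graph of `γ` in the direction `e`. -/
def IsSubgraphIn (Ω : Set (EuclideanSpace ℝ (Fin d))) (p : EuclideanSpace ℝ (Fin d)) (r : ℝ)
    (e : EuclideanSpace ℝ (Fin d)) (γ : (Submodule.span ℝ {e})ᗮ → ℝ) : Prop :=
  ∀ x ∈ ball p r,
    (x ∈ Ω ↔ ⟪e, x⟫_ℝ < γ ((Submodule.span ℝ {e})ᗮ.orthogonalProjectionOnto x))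

/-- Strict inequality either way is an open condition, hence excludes boundary points. Conversely,
moving from a point of the graph in the direction -e enters Ω at once. -/
theorem IsSubgraphIn.mem_frontier_iff (h : IsSubgraphIn Ω p r e γ) (ho : IsOpen Ω)
    (he : ‖e‖ = 1) (hγ : Continuous γ) {x : EuclideanSpace ℝ (Fin d)} (hx : x ∈ ball p r) :
    x ∈ frontier Ω ↔ ⟪e, x⟫_ℝ = γ ((Submodule.span ℝ {e})ᗮ.orthogonalProjectionOnto x) := by
  set P := (Submodule.span ℝ {e})ᗮ.orthogonalProjectionOnto with hP
  have hball : ball p r ∈ 𝓝 x := isOpen_ball.mem_nhds hx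
  have hc1 : Continuous fun y : EuclideanSpace ℝ (Fin d) => ⟪e, y⟫_ℝ := by fun_prop
  have hc2 : Continuous fun y : EuclideanSpace ℝ (Fin d) => γ (P y) := by fun_prop
  constructor
  · intro hf
    apply le_antisymm
    · by_contra! hlt
      have hev : ∀ᶠ y in 𝓝 x, y ∉ Ω := by
        filter_upwards [hball, hc2.continuousAt.eventually_lt hc1.continuousAt hlt] with y hy hy2
        rw [h y hy]
        exact not_lt.2 hy2.le
      obtain ⟨y, hy1, hy2⟩ := mem_closure_iff_frequently.1 (frontier_subset_closure hf)
        |>.and_eventually hev |>.exists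
      exact hy2 hy1
    · by_contra! hlt
      have : x ∈ Ω := (h x hx).2 hlt
      rw [ho.frontier_eq] at hf
      exact hf.2 this
  · intro heq
    rw [ho.frontier_eq]
    refine ⟨?_, fun hxΩ => absurd ((h x hx).1 hxΩ) (by rw [heq]; exact lt_irrefl _)⟩
    have ht : Tendsto (fun t : ℝ => x + (-t) • e) (𝓝[>] 0) (𝓝 x) := by
      have : Continuous fun t : ℝ => x + (-t) • e := by fun_prop
      simpa using (this.tendsto 0).mono_left nhdsWithin_le_nhds
    refine mem_closure_of_tendsto ht ?_
    filter_upwards [ht.eventually hball, self_mem_nhdsWithin] with t ht1 ht2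
    rw [h _ ht1, map_add, map_smul, projection_self, smul_zero, add_zero, inner_add_right,
      inner_smul_right, real_inner_self_eq_norm_sq, he, ← heq]
    simpa using ht2

/-- The function ⟪e, ·⟫ - γ ∘ P is a local defining function of Ω with gradient `graphNormal`, so
the sign of its derivative along w decides on which side the ray starts. -/
theorem IsSubgraphIn.isOutwardUnitNormal (h : IsSubgraphIn Ω p r e γ) (he : ‖e‖ = 1)
    (hγ : ContDiff ℝ 1 γ) {x : EuclideanSpace ℝ (Fin d)} (hx : x ∈ ball p r)
    (hxe : ⟪e, x⟫_ℝ = γ ((Submodule.span ℝ {e})ᗮ.orthogonalProjectionOnto x)) :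
    IsOutwardUnitNormal Ω x
      (‖graphNormal e γ ((Submodule.span ℝ {e})ᗮ.orthogonalProjectionOnto x)‖⁻¹ •
        graphNormal e γ ((Submodule.span ℝ {e})ᗮ.orthogonalProjectionOnto x)) := by
  set P := (Submodule.span ℝ {e})ᗮ.orthogonalProjectionOnto with hP
  set n := graphNormal e γ (P x) with hn
  have hn0 : 0 < ‖n‖ := norm_graphNormal_pos he _
  have hn1 : 0 < ‖n‖⁻¹ := inv_pos.2 hn0
  have hball : ball p r ∈ 𝓝 x := isOpen_ball.mem_nhds hx
  set G : EuclideanSpace ℝ (Fin d) → ℝ := fun y => ⟪e, y⟫_ℝ - γ (P y) with hG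
  have hGx : G x = 0 := sub_eq_zero.2 hxe
  have hline : ∀ w, HasDerivAt (fun t : ℝ => G (x + t • w)) ⟪n, w⟫_ℝ 0 := fun w => by
    have h1 : HasFDerivAt G (innerSL ℝ e - (fderiv ℝ γ (P x)).comp P) (x + (0 : ℝ) • w) := by
      rw [zero_smul, add_zero]
      exact ((innerSL ℝ e).hasFDerivAt).sub
        ((hγ.differentiable one_ne_zero (P x)).hasFDerivAt.comp x P.hasFDerivAt)
    have h2 : HasDerivAt (fun t : ℝ => x + t • w) w 0 := by
      simpa using ((hasDerivAt_id (0 : ℝ)).smul_const w).const_add x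
    rw [inner_graphNormal]
    exact h1.comp_hasDerivAt (0 : ℝ) h2
  have hnear : ∀ w, ∀ᶠ t : ℝ in 𝓝[>] 0, x + t • w ∈ ball p r := fun w => by
    have hc : Tendsto (fun t : ℝ => x + t • w) (𝓝 0) (𝓝 x) := by
      have : Continuous fun t : ℝ => x + t • w := by fun_prop
      simpa using this.tendsto 0
    exact (hc.eventually hball).filter_mono nhdsWithin_le_nhds
  have hslope : ∀ w, Tendsto (fun t : ℝ => t⁻¹ * G (x + t • w)) (𝓝[>] 0) (𝓝 ⟪n, w⟫_ℝ) := fun w => by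
    have := (hline w).tendsto_slope_zero_right
    simpa [hGx] using this
  refine ⟨?_, fun w => ⟨fun hw => ?_, fun hw => ?_⟩⟩
  · rw [norm_smul, norm_inv, norm_norm, inv_mul_cancel₀ hn0.ne']
  · rw [real_inner_smul_left] at hw
    have hw' : ⟪n, w⟫_ℝ < 0 := by
      by_contra! h
      exact absurd hw (not_lt.2 (mul_nonneg hn1.le h))
    filter_upwards [hnear w, (hslope w).eventually (gt_mem_nhds hw'), self_mem_nhdsWithin]
      with t h1 h2 h3
    rw [h _ h1, ← sub_neg]
    have h3' : (0 : ℝ) < t⁻¹ := inv_pos.2 h3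
    by_contra! h
    exact absurd h2 (not_lt.2 (mul_nonneg h3'.le h))
  · rw [real_inner_smul_left] at hw
    have hw' : 0 < ⟪n, w⟫_ℝ := pos_of_mul_pos_right hw hn1.le
    filter_upwards [hnear w, (hslope w).eventually (lt_mem_nhds hw'), self_mem_nhdsWithin]
      with t h1 h2 h3
    rw [h _ h1, ← sub_neg]
    have h3' : (0 : ℝ) < t⁻¹ := inv_pos.2 h3
    exact not_lt.2 (pos_of_mul_pos_right h2 h3'.le).le

theorem IsSubgraphIn.outwardNormal_eq (h : IsSubgraphIn Ω p r e γ) (he : ‖e‖ = 1)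
    (hγ : ContDiff ℝ 1 γ) {x : EuclideanSpace ℝ (Fin d)} (hx : x ∈ ball p r)
    (hxe : ⟪e, x⟫_ℝ = γ ((Submodule.span ℝ {e})ᗮ.orthogonalProjectionOnto x)) :
    outwardNormal Ω x =
      ‖graphNormal e γ ((Submodule.span ℝ {e})ᗮ.orthogonalProjectionOnto x)‖⁻¹ •
        graphNormal e γ ((Submodule.span ℝ {e})ᗮ.orthogonalProjectionOnto x) := by
  have hn := h.isOutwardUnitNormal he hγ hx hxe
  have hex : ∃ n, IsOutwardUnitNormal Ω x n := ⟨_, hn⟩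
  have ho : IsOutwardUnitNormal Ω x (outwardNormal Ω x) := by
    unfold outwardNormal
    rw [dif_pos hex]
    exact hex.choose_spec
  exact ho.unique hn

/-- The divergence theorem for functions supported near a boundary point. -/
theorem IsSubgraphIn.setIntegral_fderiv {F : Type*} [NormedAddCommGroup F] [NormedSpace ℝ F]
    [CompleteSpace F] (h : IsSubgraphIn Ω p r e γ)
    (ho : IsOpen Ω) (he : ‖e‖ = 1) (hγ : ContDiff ℝ 1 γ) {f : EuclideanSpace ℝ (Fin d) → F}
    (hf : ContDiff ℝ 1 f) (hc : HasCompactSupport f) (hs : tsupport f ⊆ ball p r)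
    (w : EuclideanSpace ℝ (Fin d)) :
    ∫ y in Ω, fderiv ℝ f y w = ∫ y, ⟪outwardNormal Ω y, w⟫_ℝ • f y ∂(surfaceMeasure Ω) := by
  classical
  set P := (Submodule.span ℝ {e})ᗮ.orthogonalProjectionOnto with hP
  have hc1 : Continuous fun y : EuclideanSpace ℝ (Fin d) => ⟪e, y⟫_ℝ := by fun_prop
  have hc2 : Continuous fun y : EuclideanSpace ℝ (Fin d) => γ (P y) := by
    have := hγ.continuous
    fun_prop
  -- Ω and the full subgraph agree on the ball that contains the support of f, and likewise their
  -- boundaries below; outside it the integrands vanish.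
  have hleft : ∫ y in Ω, fderiv ℝ f y w
      = ∫ y in {y | ⟪e, y⟫_ℝ < γ (P y)}, fderiv ℝ f y w := by
    rw [← integral_indicator ho.measurableSet,
      ← integral_indicator (isOpen_lt hc1 hc2).measurableSet]
    congr 1 with y
    by_cases hy : y ∈ ball p r
    · by_cases hyΩ : y ∈ Ω
      · rw [indicator_of_mem hyΩ, indicator_of_mem]
        exact (h y hy).1 hyΩ
      · rw [indicator_of_notMem hyΩ, indicator_of_notMem]
        exact fun h' => hyΩ ((h y hy).2 h')
    · have h0 : fderiv ℝ f y = 0 := fderiv_of_notMem_tsupport ℝ fun h' => hy (hs h')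
      simp [indicator, h0]
  have hright : ∫ y, ⟪outwardNormal Ω y, w⟫_ℝ • f y ∂(surfaceMeasure Ω)
      = ∫ y in range (graphMap e γ), (‖graphNormal e γ (P y)‖⁻¹ * ⟪graphNormal e γ (P y), w⟫_ℝ) • f y
          ∂(μHE[d - 1]) := by
    rw [surfaceMeasure, ← integral_indicator isClosed_frontier.measurableSet,
      ← integral_indicator (isClosedEmbedding_graphMap hγ.continuous).isClosed_range.measurableSet]
    congr 1 with y
    by_cases hy : y ∈ ball p r
    · by_cases hyF : ⟪e, y⟫_ℝ = γ (P y)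
      · rw [indicator_of_mem ((h.mem_frontier_iff ho he hγ.continuous hy).2 hyF),
          indicator_of_mem ((mem_range_graphMap he).2 hyF), h.outwardNormal_eq he hγ hy hyF,
          real_inner_smul_left]
      · rw [indicator_of_notMem (fun h' => hyF ((h.mem_frontier_iff ho he hγ.continuous hy).1 h')),
          indicator_of_notMem (fun h' => hyF ((mem_range_graphMap he).1 h'))]
    · have h0 : f y = 0 := image_eq_zero_of_notMem_tsupport fun h' => hy (hs h')
      simp [indicator, h0]
  -- The area density ‖n‖ cancels the factor ‖n‖⁻¹ that normalizes n = `graphNormal`.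
  have harea := setIntegral_range_graphMap he hγ (fun y =>
    (‖graphNormal e γ (P y)‖⁻¹ * ⟪graphNormal e γ (P y), w⟫_ℝ) • f y)
  rw [finrank_euclideanSpace_fin] at harea
  rw [hleft, hright, setIntegral_subgraph_fderiv he hγ hf hc w, harea]
  congr 1 with x
  have hn := norm_graphNormal_pos (γ := γ) he x
  simp only [hP]
  rw [projection_graphMap, smul_smul, ← mul_assoc, mul_inv_cancel₀ hn.ne', one_mul,
    inner_graphNormal]

end Chart

/-! ### From boundary charts to the whole domain -/

section Domain

variable {d : ℕ} {Ω : Set (EuclideanSpace ℝ (Fin d))}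

theorem continuousOn_outwardNormal (ho : IsOpen Ω) (hΩ : HasC1Boundary Ω) :
    ContinuousOn (outwardNormal Ω) (frontier Ω) := by
  intro p hp
  obtain ⟨e, he, γ, hγ, r, hr, hloc⟩ := hΩ p hp
  have hsub : IsSubgraphIn Ω p r e γ := hloc
  set P := (Submodule.span ℝ {e})ᗮ.orthogonalProjectionOnto with hP
  have hcn : Continuous fun y => graphNormal e γ (P y) :=
    (continuous_graphNormal hγ).comp P.continuous
  have hc : Continuous fun y => ‖graphNormal e γ (P y)‖⁻¹ • graphNormal e γ (P y) :=
    (hcn.norm.inv₀ fun y => (norm_graphNormal_pos he _).ne').smul hcn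
  refine (hc.continuousWithinAt (s := frontier Ω)).congr_of_eventuallyEq ?_ ?_
  · filter_upwards [self_mem_nhdsWithin, nhdsWithin_le_nhds (ball_mem_nhds p hr)] with y hy1 hy2
    exact hsub.outwardNormal_eq he hγ hy2 ((hsub.mem_frontier_iff ho he hγ.continuous hy2).1 hy1)
  · exact hsub.outwardNormal_eq he hγ (mem_ball_self hr)
      ((hsub.mem_frontier_iff ho he hγ.continuous (mem_ball_self hr)).1 hp)

theorem IsRegularBoundedDomain.isCompact_closure (hΩ : IsRegularBoundedDomain Ω) :
    IsCompact (closure Ω) := hΩ.isBounded.isCompact_closure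

theorem IsRegularBoundedDomain.isCompact_frontier (hΩ : IsRegularBoundedDomain Ω) :
    IsCompact (frontier Ω) :=
  hΩ.isCompact_closure.of_isClosed_subset isClosed_frontier frontier_subset_closure

/-- By compactness a local bound suffices, and near each point the boundary lies in the image of a
compact set under the parametrization of a graph. -/
theorem IsRegularBoundedDomain.isFiniteMeasure_surfaceMeasure (hΩ : IsRegularBoundedDomain Ω) :
    IsFiniteMeasure (surfaceMeasure Ω) := by
  refine ⟨?_⟩
  rw [surfaceMeasure, Measure.restrict_apply_univ]
  refine hΩ.isCompact_frontier.measure_lt_top_of_nhdsWithin fun p hp => ?_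
  obtain ⟨e, he, γ, hγ, r, hr, hloc⟩ := hΩ.hasC1Boundary p hp
  have hsub : IsSubgraphIn Ω p r e γ := hloc
  set P := (Submodule.span ℝ {e})ᗮ.orthogonalProjectionOnto with hP
  refine ⟨frontier Ω ∩ ball p r, inter_mem self_mem_nhdsWithin
    (nhdsWithin_le_nhds (ball_mem_nhds p hr)), ?_⟩
  have hK : IsCompact (P '' closedBall p r) := (isCompact_closedBall p r).image P.continuous
  have hfin := measure_graphMap_image_lt_top he hγ hK
  rw [finrank_euclideanSpace_fin] at hfin
  refine (measure_mono ?_).trans_lt hfin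
  rintro y ⟨hy1, hy2⟩
  refine ⟨P y, mem_image_of_mem _ (ball_subset_closedBall hy2), ?_⟩
  rw [graphMap, ← (hsub.mem_frontier_iff hΩ.isOpen he hγ.continuous hy2).1 hy1,
    projection_add_inner_smul he]

variable {F : Type*} [NormedAddCommGroup F] [NormedSpace ℝ F]

theorem IsRegularBoundedDomain.integrable_surfaceMeasure (hΩ : IsRegularBoundedDomain Ω)
    {f : EuclideanSpace ℝ (Fin d) → F} (hf : ContinuousOn f (frontier Ω)) :
    Integrable f (surfaceMeasure Ω) := by
  have := hΩ.isFiniteMeasure_surfaceMeasure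
  have hm : surfaceMeasure Ω = (surfaceMeasure Ω).restrict (frontier Ω) := by
    rw [surfaceMeasure, Measure.restrict_restrict isClosed_frontier.measurableSet, inter_self]
  rw [hm]
  exact hf.integrableOn_compact hΩ.isCompact_frontier

theorem IsRegularBoundedDomain.integrableOn (hΩ : IsRegularBoundedDomain Ω)
    {f : EuclideanSpace ℝ (Fin d) → F} (hf : ContinuousOn f (closure Ω)) :
    IntegrableOn f Ω :=
  (hf.integrableOn_compact hΩ.isCompact_closure).mono_set subset_closure

/-- The difference of the two sides of the divergence theorem. -/
def divergenceDefect (Ω : Set (EuclideanSpace ℝ (Fin d))) (w : EuclideanSpace ℝ (Fin d))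
    (f : EuclideanSpace ℝ (Fin d) → F) : F :=
  (∫ y in Ω, fderiv ℝ f y w) - ∫ y, ⟪outwardNormal Ω y, w⟫_ℝ • f y ∂(surfaceMeasure Ω)

theorem IsRegularBoundedDomain.divergenceDefect_sub (hΩ : IsRegularBoundedDomain Ω)
    (w : EuclideanSpace ℝ (Fin d)) {f g : EuclideanSpace ℝ (Fin d) → F} (hf : ContDiff ℝ 1 f)
    (hg : ContDiff ℝ 1 g) :
    divergenceDefect Ω w (f - g) = divergenceDefect Ω w f - divergenceDefect Ω w g := by
  have hi : ∀ {h : EuclideanSpace ℝ (Fin d) → F}, ContDiff ℝ 1 h →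
      IntegrableOn (fun y => fderiv ℝ h y w) Ω := fun hh =>
    hΩ.integrableOn ((hh.continuous_fderiv one_ne_zero).clm_apply continuous_const).continuousOn
  have hb : ∀ {h : EuclideanSpace ℝ (Fin d) → F}, ContDiff ℝ 1 h →
      Integrable (fun y => ⟪outwardNormal Ω y, w⟫_ℝ • h y) (surfaceMeasure Ω) := fun hh =>
    hΩ.integrable_surfaceMeasure (((continuousOn_outwardNormal hΩ.isOpen hΩ.hasC1Boundary).inner
      continuousOn_const).smul hh.continuous.continuousOn)
  have h1 : ∀ y, fderiv ℝ (f - g) y w = fderiv ℝ f y w - fderiv ℝ g y w := fun y => by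
    rw [fderiv_sub (hf.differentiable one_ne_zero y) (hg.differentiable one_ne_zero y)]
    rfl
  simp only [divergenceDefect, h1, Pi.sub_apply, smul_sub]
  rw [integral_sub (hi hf) (hi hg), integral_sub (hb hf) (hb hg)]
  abel

/-- Near an interior point the support misses ∂Ω and both integrals vanish; near a boundary point
this is the theorem in a chart. -/
theorem IsRegularBoundedDomain.exists_divergenceDefect_eq_zero [CompleteSpace F]
    (hΩ : IsRegularBoundedDomain Ω)
    (w : EuclideanSpace ℝ (Fin d)) {p : EuclideanSpace ℝ (Fin d)} (hp : p ∈ closure Ω) :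
    ∃ r > 0, ∀ f : EuclideanSpace ℝ (Fin d) → F, ContDiff ℝ 1 f → tsupport f ⊆ ball p r →
      divergenceDefect Ω w f = 0 := by
  have hcomp : ∀ {f : EuclideanSpace ℝ (Fin d) → F} {r : ℝ}, tsupport f ⊆ ball p r →
      HasCompactSupport f := fun {f r} h =>
    (isCompact_closedBall p r).of_isClosed_subset (isClosed_tsupport f)
      (h.trans ball_subset_closedBall)
  by_cases hpΩ : p ∈ Ω
  · obtain ⟨r, hr, hball⟩ := Metric.isOpen_iff.1 hΩ.isOpen p hpΩ
    refine ⟨r, hr, fun f hf hs => ?_⟩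
    have h1 : ∫ y in Ω, fderiv ℝ f y w = 0 := by
      rw [setIntegral_eq_integral_of_forall_compl_eq_zero,
        integral_fderiv_apply_eq_zero hf (hcomp hs)]
      intro y hy
      rw [fderiv_of_notMem_tsupport ℝ fun h => hy (hball (hs h))]
      rfl
    have h2 : ∫ y, ⟪outwardNormal Ω y, w⟫_ℝ • f y ∂(surfaceMeasure Ω) = 0 := by
      rw [surfaceMeasure]
      refine setIntegral_eq_zero_of_forall_eq_zero fun y hy => ?_
      rw [hΩ.isOpen.frontier_eq] at hy
      rw [image_eq_zero_of_notMem_tsupport fun h => hy.2 (hball (hs h)), smul_zero]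
    rw [divergenceDefect, h1, h2, sub_zero]
  · have hpF : p ∈ frontier Ω := by
      rw [hΩ.isOpen.frontier_eq]
      exact ⟨hp, hpΩ⟩
    obtain ⟨e, he, γ, hγ, r, hr, hloc⟩ := hΩ.hasC1Boundary p hpF
    have hsub : IsSubgraphIn Ω p r e γ := hloc
    refine ⟨r, hr, fun f hf hs => sub_eq_zero.2 ?_⟩
    exact hsub.setIntegral_fderiv hΩ.isOpen he hγ hf (hcomp hs) hs w

/-- The divergence theorem: the integral over `Ω` of the derivative of a `C¹` function in a fixed
direction `w` is the boundary integral of the function against the `w`-component of the outward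
unit normal. -/
theorem IsRegularBoundedDomain.setIntegral_fderiv [CompleteSpace F]
    (hΩ : IsRegularBoundedDomain Ω)
    (w : EuclideanSpace ℝ (Fin d)) {f : EuclideanSpace ℝ (Fin d) → F} (hf : ContDiff ℝ 1 f) :
    ∫ y in Ω, fderiv ℝ f y w = ∫ y, ⟪outwardNormal Ω y, w⟫_ℝ • f y ∂(surfaceMeasure Ω) := by
  classical
  rw [← sub_eq_zero]
  change divergenceDefect Ω w f = 0
  choose! r hr hr0 using fun p (hp : p ∈ closure Ω) =>
    hΩ.exists_divergenceDefect_eq_zero (F := F) w hp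
  obtain ⟨t, ht, hcov⟩ := hΩ.isCompact_closure.elim_nhds_subcover (fun p => ball p (r p / 3))
    (fun p hp => ball_mem_nhds p (by have := hr p hp; positivity))
  let b : ∀ p : closure Ω, ContDiffBump (p : EuclideanSpace ℝ (Fin d)) := fun p =>
    ⟨r p / 3, r p / 2, by have := hr p p.2; positivity, by have := hr p p.2; linarith⟩
  -- The value 0 for centres outside the closure only makes the family total.
  let χ : EuclideanSpace ℝ (Fin d) → EuclideanSpace ℝ (Fin d) → ℝ := fun p =>
    if hp : p ∈ closure Ω then b ⟨p, hp⟩ else 0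
  have hχ : ∀ p, ContDiff ℝ 1 (χ p) := fun p => by
    by_cases hp : p ∈ closure Ω
    · simp only [χ, dif_pos hp]
      exact (b ⟨p, hp⟩).contDiff
    · simp only [χ, dif_neg hp]
      exact contDiff_const
  have hχs : ∀ p ∈ closure Ω, tsupport (χ p) ⊆ ball p (r p) := fun p hp => by
    simp only [χ, dif_pos hp]
    rw [(b ⟨p, hp⟩).tsupport_eq]
    refine closedBall_subset_ball ?_
    have := hr p hp
    change r p / 2 < r p
    linarith
  have hχ1 : ∀ p ∈ closure Ω, ∀ y ∈ ball p (r p / 3), χ p y = 1 := fun p hp y hy => by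
    simp only [χ, dif_pos hp]
    exact (b ⟨p, hp⟩).one_of_mem_closedBall (ball_subset_closedBall hy)
  -- This replaces a partition of unity. Multiplying by 1 - χ p subtracts a function supported in a
  -- ball where the defect is zero, so the defect never changes; after all factors the function
  -- vanishes on a neighbourhood of the closure of Ω.
  have hprod : ∀ s : Finset (EuclideanSpace ℝ (Fin d)), (∀ p ∈ s, p ∈ closure Ω) →
      ContDiff ℝ 1 (fun y => (∏ p ∈ s, (1 - χ p y)) • f y) ∧
      divergenceDefect Ω w (fun y => (∏ p ∈ s, (1 - χ p y)) • f y) = divergenceDefect Ω w f := by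
    intro s
    induction s using Finset.induction_on with
    | empty => intro _; simpa using hf
    | insert p s hps ih =>
      intro hs
      obtain ⟨ih1, ih2⟩ := ih fun q hq => hs q (Finset.mem_insert_of_mem hq)
      have hp := hs p (Finset.mem_insert_self p s)
      have hcd : ContDiff ℝ 1 (fun y => χ p y • (∏ q ∈ s, (1 - χ q y)) • f y) := (hχ p).smul ih1
      have heq : (fun y => (∏ q ∈ insert p s, (1 - χ q y)) • f y)
          = (fun y => (∏ q ∈ s, (1 - χ q y)) • f y)
            - fun y => χ p y • (∏ q ∈ s, (1 - χ q y)) • f y := by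
        funext y
        rw [Finset.prod_insert hps, Pi.sub_apply, mul_smul, sub_smul, one_smul]
      rw [heq]
      refine ⟨ih1.sub hcd, ?_⟩
      rw [hΩ.divergenceDefect_sub w ih1 hcd, ih2, hr0 p hp _ hcd, sub_zero]
      exact (tsupport_smul_subset_left _ _).trans (hχs p hp)
  obtain ⟨_, h2⟩ := hprod t ht
  rw [← h2]
  have hzero : ∀ y ∈ ⋃ p ∈ t, ball p (r p / 3), (∏ p ∈ t, (1 - χ p y)) • f y = 0 := by
    intro y hy
    obtain ⟨p, hp, hyp⟩ := mem_iUnion₂.1 hy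
    rw [Finset.prod_eq_zero hp (by rw [hχ1 p (ht p hp) y hyp, sub_self]), zero_smul]
  have hopen : IsOpen (⋃ p ∈ t, ball p (r p / 3)) := isOpen_biUnion fun p _ => isOpen_ball
  rw [divergenceDefect, setIntegral_eq_zero_of_forall_eq_zero, surfaceMeasure,
    setIntegral_eq_zero_of_forall_eq_zero, sub_zero]
  · intro y hy
    rw [hzero y (hcov (frontier_subset_closure hy)), smul_zero]
  · intro y hy
    have : (fun y => (∏ p ∈ t, (1 - χ p y)) • f y) =ᶠ[𝓝 y] fun _ => 0 := by
      filter_upwards [hopen.mem_nhds (hcov (subset_closure hy))] with x hx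
      exact hzero x hx
    rw [this.fderiv_eq, fderiv_const_apply]
    rfl

end Domain

/-! ### Entire power series -/

/-- The sum of the real power series with coefficients `a`. -/
def powSer (a : ℕ → ℝ) (s : ℝ) : ℝ := ∑' m, a m * s ^ m

/-- A growth condition under which a power series converges everywhere. -/
def IsEntireCoeff (a : ℕ → ℝ) : Prop := ∃ C : ℝ, 1 ≤ C ∧ ∀ m, |a m| ≤ C ^ (m + 1) / (m ! : ℝ)

/-- The coefficients of the differentiated power series. -/
def derivCoeff (a : ℕ → ℝ) (m : ℕ) : ℝ := (m + 1) * a (m + 1)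

theorem IsEntireCoeff.derivCoeff {a : ℕ → ℝ} (ha : IsEntireCoeff a) :
    IsEntireCoeff (derivCoeff a) := by
  obtain ⟨C, hC, h⟩ := ha
  -- The factor m + 1 cancels against (m + 1)!, leaving C^(m + 2), and m + 2 ≤ 2 (m + 1) with C ≥ 1.
  refine ⟨C ^ 2, one_le_pow₀ hC, fun m => ?_⟩
  have hf : (0 : ℝ) < (m ! : ℝ) := by positivity
  have hm : (0 : ℝ) < (m : ℝ) + 1 := by positivity
  calc |InverseSource.derivCoeff a m| = (m + 1) * |a (m + 1)| := by
        rw [InverseSource.derivCoeff, abs_mul, abs_of_pos hm]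
    _ ≤ (m + 1) * (C ^ (m + 1 + 1) / ((m + 1)! : ℝ)) := by gcongr; exact h (m + 1)
    _ = C ^ (m + 2) / (m ! : ℝ) := by
        rw [Nat.factorial_succ]
        push_cast
        field_simp
    _ ≤ (C ^ 2) ^ (m + 1) / (m ! : ℝ) := by
        rw [← pow_mul]
        gcongr
        omega

theorem IsEntireCoeff.summable {a : ℕ → ℝ} (ha : IsEntireCoeff a) (s : ℝ) :
    Summable fun m => a m * s ^ m := by
  obtain ⟨C, hC, h⟩ := ha
  refine Summable.of_norm_bounded (g := fun m => C * ((C * |s|) ^ m / (m ! : ℝ)))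
    ((Real.summable_pow_div_factorial _).mul_left C) fun m => ?_
  rw [norm_mul, norm_pow, Real.norm_eq_abs, Real.norm_eq_abs]
  calc |a m| * |s| ^ m ≤ C ^ (m + 1) / (m ! : ℝ) * |s| ^ m := by gcongr; exact h m
    _ = _ := by rw [mul_pow]; ring

theorem IsEntireCoeff.hasDerivAt {a : ℕ → ℝ} (ha : IsEntireCoeff a) (s : ℝ) :
    HasDerivAt (powSer a) (powSer (InverseSource.derivCoeff a) s) s := by
  set R : ℝ := |s| + 1 with hR
  have hR0 : 0 ≤ R := by positivity
  -- A majorant of the termwise derivatives on the ball of radius |s| + 1; after dropping the zero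
  -- term at m = 0 it is the absolute differentiated series at R.
  have hsum : Summable fun m : ℕ => |a m| * (m * R ^ (m - 1)) := by
    rw [← summable_nat_add_iff 1]
    refine (ha.derivCoeff.summable R).abs.congr fun m => ?_
    have hm : (0 : ℝ) < (m : ℝ) + 1 := by positivity
    rw [InverseSource.derivCoeff, abs_mul, abs_mul, abs_of_pos hm, abs_of_nonneg (pow_nonneg hR0 _)]
    push_cast
    ring
  have hs : s ∈ ball (0 : ℝ) R := by
    rw [mem_ball_zero_iff, Real.norm_eq_abs, hR]
    linarith
  have key := hasDerivAt_tsum_of_isPreconnected (g := fun (m : ℕ) y => a m * y ^ m)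
    (g' := fun (m : ℕ) y => a m * (m * y ^ (m - 1))) hsum isOpen_ball
    (convex_ball (0 : ℝ) R).isPreconnected
    (fun m y _ => (hasDerivAt_pow m y).const_mul (a m))
    (fun m y hy => by
      rw [mem_ball_zero_iff, Real.norm_eq_abs] at hy
      rw [norm_mul, norm_mul, norm_pow, Real.norm_eq_abs, Real.norm_eq_abs, Real.norm_eq_abs,
        Nat.abs_cast]
      gcongr)
    hs (ha.summable s) hs
  have hshift : ∑' m : ℕ, a m * (m * s ^ (m - 1)) = powSer (InverseSource.derivCoeff a) s := by
    rw [Summable.tsum_eq_zero_add]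
    · simp only [Nat.cast_zero, zero_mul, mul_zero, zero_add, powSer]
      refine tsum_congr fun m => ?_
      rw [InverseSource.derivCoeff, Nat.add_sub_cancel]
      push_cast
      ring
    · refine (summable_nat_add_iff 1).1 ((ha.derivCoeff.summable s).congr fun m => ?_)
      rw [InverseSource.derivCoeff, Nat.add_sub_cancel]
      push_cast
      ring
  rw [← hshift]
  exact key

theorem IsEntireCoeff.continuous {a : ℕ → ℝ} (ha : IsEntireCoeff a) : Continuous (powSer a) :=
  continuous_iff_continuousAt.2 fun s => (ha.hasDerivAt s).continuousAt

theorem powSer_zero (a : ℕ → ℝ) : powSer a 0 = a 0 := by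
  rw [powSer, tsum_eq_single 0 fun m hm => by simp [hm]]
  simp

/-- The operator `4 s A'' + 2 D A' + K A` on power series. -/
theorem IsEntireCoeff.operator_eq {a : ℕ → ℝ} (ha : IsEntireCoeff a) (D K s : ℝ) :
    4 * s * powSer (InverseSource.derivCoeff (InverseSource.derivCoeff a)) s
        + 2 * D * powSer (InverseSource.derivCoeff a) s + K * powSer a s
      = powSer (fun m => (4 * m + 2 * D) * ((m + 1) * a (m + 1)) + K * a m) s := by
  have h1 : HasSum (fun m : ℕ => 4 * m * ((m + 1) * a (m + 1)) * s ^ m)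
      (4 * s * powSer (InverseSource.derivCoeff (InverseSource.derivCoeff a)) s) := by
    rw [← hasSum_nat_add_iff' 1]
    have := (ha.derivCoeff.derivCoeff.summable s).hasSum.mul_left (4 * s)
    convert! this using 1
    · funext m
      simp only [InverseSource.derivCoeff]
      push_cast
      ring
    · simp [powSer]
  have h2 := (ha.derivCoeff.summable s).hasSum.mul_left (2 * D)
  have h3 := (ha.summable s).hasSum.mul_left K
  have h := (h1.add h2).add h3
  simp only [powSer] at h ⊢
  rw [← h.tsum_eq]
  refine tsum_congr fun m => ?_
  simp only [InverseSource.derivCoeff]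
  ring

/-! ### The radial profile of the Green function and of its imaginary part -/

/-- A profile `G` such that `x ↦ G(‖x‖²)` is a `C²` solution of `Δv + K v = 0` on `ℝ^d`. -/
structure IsEntireProfile (d : ℕ) (K : ℝ) (G G1 G2 : ℝ → ℝ) : Prop where
  hasDerivAt : ∀ s, HasDerivAt G (G1 s) s
  hasDerivAt' : ∀ s, HasDerivAt G1 (G2 s) s
  continuous : Continuous G2
  ode : ∀ s, 4 * s * G2 s + 2 * d * G1 s + K * G s = 0

/-- A profile `g` such that `x ↦ g(‖x‖²)` is a fundamental solution: it satisfies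
`Δw + K w = 0` away from the origin and has the singularity of the Newtonian potential there. -/
structure IsFundamentalProfile (d : ℕ) (K : ℝ) (g g1 g2 : ℝ → ℂ) : Prop where
  hasDerivAt : ∀ s, 0 < s → HasDerivAt g (g1 s) s
  hasDerivAt' : ∀ s, 0 < s → HasDerivAt g1 (g2 s) s
  continuousOn : ContinuousOn g2 (Ioi 0)
  ode : ∀ s, 0 < s → 4 * s * g2 s + 2 * d * g1 s + K * g s = 0
  tendsto_zero : Tendsto (fun s => (√s : ℂ) ^ d * g s) (𝓝[>] 0) (𝓝 0)
  -- Unit flux: the sphere of radius r has area d V r^(d-1), with V the volume of the unit ball, and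
  -- the radial derivative of g(r²) is 2 r g1, so the total flux 2 d V r^d g1 tends to -1.
  tendsto_deriv : Tendsto (fun s => (√s : ℂ) ^ d * g1 s) (𝓝[>] 0)
    (𝓝 (-(1 / (2 * d * (volume : Measure (EuclideanSpace ℝ (Fin d))).real (ball 0 1)) : ℝ)))

/-- The recursion is the radial Helmholtz equation read off coefficient by coefficient. -/
theorem IsEntireCoeff.isEntireProfile {a : ℕ → ℝ} (ha : IsEntireCoeff a) (d : ℕ) (K c : ℝ)
    (h : ∀ m : ℕ, (4 * m + 2 * d) * ((m + 1) * a (m + 1)) + K * a m = 0) :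
    IsEntireProfile d K (fun s => c * powSer a s) (fun s => c * powSer (InverseSource.derivCoeff a) s)
      (fun s => c * powSer (InverseSource.derivCoeff (InverseSource.derivCoeff a)) s) where
  hasDerivAt s := (ha.hasDerivAt s).const_mul c
  hasDerivAt' s := (ha.derivCoeff.hasDerivAt s).const_mul c
  continuous := continuous_const.mul ha.derivCoeff.derivCoeff.continuous
  ode s := by
    have := ha.operator_eq d K s
    simp only [h] at this
    have h0 : powSer (fun _ => 0) s = 0 := by simp [powSer]
    rw [h0] at this
    linear_combination c * this

/-- The coefficients of `J₀(k√s)` as a power series in `s`. -/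
def besselCoeff (k : ℝ) (m : ℕ) : ℝ := (-(k ^ 2 / 4)) ^ m / (m ! : ℝ) ^ 2

/-- The coefficients of the logarithm-free part of `Y₀(k√s)` as a power series in `s`. -/
def besselHarmonicCoeff (k : ℝ) (m : ℕ) : ℝ := ((harmonic m : ℚ) : ℝ) * besselCoeff k m

/-- The coefficients of `sinc(k√s)` as a power series in `s`. -/
def sincCoeff (k : ℝ) (m : ℕ) : ℝ := (-(k ^ 2)) ^ m / ((2 * m + 1)! : ℝ)

theorem harmonic_nonneg (m : ℕ) : (0 : ℝ) ≤ ((harmonic m : ℚ) : ℝ) := by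
  rw [harmonic]
  push_cast
  positivity

/-- A crude bound is enough: one of the two factorials in the Bessel coefficients absorbs the
harmonic number. -/
theorem harmonic_le_factorial (m : ℕ) : ((harmonic m : ℚ) : ℝ) ≤ (m ! : ℝ) := by
  have h1 : ((harmonic m : ℚ) : ℝ) ≤ m := by
    rw [harmonic]
    push_cast
    calc ∑ i ∈ Finset.range m, ((i : ℝ) + 1)⁻¹ ≤ ∑ i ∈ Finset.range m, (1 : ℝ) :=
          Finset.sum_le_sum fun i _ => inv_le_one_of_one_le₀ (by
            have : (0 : ℝ) ≤ i := by positivity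
            linarith)
      _ = m := by simp
  exact h1.trans (by exact_mod_cast Nat.self_le_factorial m)

theorem isEntireCoeff_besselCoeff (k : ℝ) : IsEntireCoeff (besselCoeff k) := by
  refine ⟨k ^ 2 / 4 + 1, by nlinarith [sq_nonneg k], fun m => ?_⟩
  have hf : (1 : ℝ) ≤ (m ! : ℝ) := by exact_mod_cast Nat.succ_le_of_lt (Nat.factorial_pos m)
  rw [besselCoeff, abs_div, abs_pow, abs_neg, abs_of_nonneg (by positivity : 0 ≤ k ^ 2 / 4),
    abs_of_nonneg (by positivity : 0 ≤ (m ! : ℝ) ^ 2)]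
  have hpow : (k ^ 2 / 4) ^ m ≤ (k ^ 2 / 4 + 1) ^ (m + 1) :=
    calc (k ^ 2 / 4) ^ m ≤ (k ^ 2 / 4 + 1) ^ m := by gcongr; linarith
      _ ≤ _ := pow_le_pow_right₀ (by nlinarith [sq_nonneg k]) (Nat.le_succ m)
  gcongr
  nlinarith

theorem isEntireCoeff_besselHarmonicCoeff (k : ℝ) : IsEntireCoeff (besselHarmonicCoeff k) := by
  refine ⟨k ^ 2 / 4 + 1, by nlinarith [sq_nonneg k], fun m => ?_⟩
  have hf : (0 : ℝ) < (m ! : ℝ) := by positivity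
  rw [besselHarmonicCoeff, besselCoeff, abs_mul, abs_div, abs_pow, abs_neg,
    abs_of_nonneg (by positivity : 0 ≤ k ^ 2 / 4), abs_of_nonneg (harmonic_nonneg m),
    abs_of_nonneg (by positivity : 0 ≤ (m ! : ℝ) ^ 2)]
  have hpow : (k ^ 2 / 4) ^ m ≤ (k ^ 2 / 4 + 1) ^ (m + 1) :=
    calc (k ^ 2 / 4) ^ m ≤ (k ^ 2 / 4 + 1) ^ m := by gcongr; linarith
      _ ≤ _ := pow_le_pow_right₀ (by nlinarith [sq_nonneg k]) (Nat.le_succ m)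
  calc ((harmonic m : ℚ) : ℝ) * ((k ^ 2 / 4) ^ m / (m ! : ℝ) ^ 2)
      ≤ (m ! : ℝ) * ((k ^ 2 / 4 + 1) ^ (m + 1) / (m ! : ℝ) ^ 2) := by
        gcongr
        exact harmonic_le_factorial m
    _ = _ := by field_simp

theorem isEntireCoeff_sincCoeff (k : ℝ) : IsEntireCoeff (sincCoeff k) := by
  refine ⟨k ^ 2 + 1, by nlinarith [sq_nonneg k], fun m => ?_⟩
  rw [sincCoeff, abs_div, abs_pow, abs_neg, abs_of_nonneg (by positivity : 0 ≤ k ^ 2),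
    Nat.abs_cast]
  have hpow : (k ^ 2) ^ m ≤ (k ^ 2 + 1) ^ (m + 1) :=
    calc (k ^ 2) ^ m ≤ (k ^ 2 + 1) ^ m := by gcongr; linarith
      _ ≤ _ := pow_le_pow_right₀ (by nlinarith [sq_nonneg k]) (Nat.le_succ m)
  have hfac : (m ! : ℝ) ≤ ((2 * m + 1)! : ℝ) := by
    exact_mod_cast Nat.factorial_le (by omega)
  gcongr

/-- This is the radial Helmholtz equation for d = 2 on coefficients, since (4m + 4)(m + 1) = 4 (m +
1)²; `sincCoeff_succ` plays the same role for d = 3. -/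
theorem besselCoeff_succ (k : ℝ) (m : ℕ) :
    4 * (m + 1) ^ 2 * besselCoeff k (m + 1) = -(k ^ 2 * besselCoeff k m) := by
  rw [besselCoeff, besselCoeff, Nat.factorial_succ, pow_succ (-(k ^ 2 / 4))]
  push_cast
  field_simp

theorem sincCoeff_succ (k : ℝ) (m : ℕ) :
    (2 * m + 2) * (2 * m + 3) * sincCoeff k (m + 1) = -(k ^ 2 * sincCoeff k m) := by
  rw [sincCoeff, sincCoeff, show 2 * (m + 1) + 1 = 2 * m + 1 + 1 + 1 by ring, Nat.factorial_succ,
    Nat.factorial_succ (2 * m + 1), pow_succ]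
  push_cast
  field_simp
  ring

theorem besselJ0_eq_powSer (k r : ℝ) : besselJ0 (k * r) = powSer (besselCoeff k) (r ^ 2) := by
  rw [besselJ0, powSer]
  refine tsum_congr fun m => ?_
  rw [besselCoeff, neg_eq_neg_one_mul (k ^ 2 / 4), mul_pow (-1) (k ^ 2 / 4), pow_mul (k * r / 2),
    show (k * r / 2) ^ 2 = k ^ 2 / 4 * r ^ 2 by ring, mul_pow (k ^ 2 / 4) (r ^ 2)]
  generalize k ^ 2 / 4 = q
  ring

/-- Writing log (kr/2) as half of log r² + log (k²/4) makes every ingredient a function of s = r².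
-/
theorem besselY0_eq_powSer {k r : ℝ} (hk : 0 < k) (hr : 0 < r) :
    besselY0 (k * r) = 1 / Real.pi *
      ((Real.log (r ^ 2) + (Real.log (k ^ 2 / 4) + 2 * Real.eulerMascheroniConstant))
          * powSer (besselCoeff k) (r ^ 2)
        - 2 * powSer (besselHarmonicCoeff k) (r ^ 2)) := by
  have hlog : Real.log (k * r / 2) = (Real.log (r ^ 2) + Real.log (k ^ 2 / 4)) / 2 := by
    rw [← Real.log_mul (by positivity) (by positivity),
      show r ^ 2 * (k ^ 2 / 4) = (k * r / 2) ^ 2 by ring, Real.log_pow]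
    push_cast
    ring
  have hB : ∑' m : ℕ, (-1) ^ m * ((harmonic m : ℚ) : ℝ) / ((m ! : ℕ) : ℝ) ^ 2 * (k * r / 2) ^ (2 * m)
      = powSer (besselHarmonicCoeff k) (r ^ 2) := by
    rw [powSer]
    refine tsum_congr fun m => ?_
    rw [besselHarmonicCoeff, besselCoeff, neg_eq_neg_one_mul (k ^ 2 / 4),
      mul_pow (-1) (k ^ 2 / 4), pow_mul (k * r / 2),
      show (k * r / 2) ^ 2 = k ^ 2 / 4 * r ^ 2 by ring, mul_pow (k ^ 2 / 4) (r ^ 2)]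
    generalize k ^ 2 / 4 = q
    ring
  rw [besselY0, hB, besselJ0_eq_powSer, hlog]
  ring

theorem sinc_eq_powSer (k r : ℝ) : Real.sinc (k * r) = powSer (sincCoeff k) (r ^ 2) := by
  by_cases h : k * r = 0
  · rw [h, Real.sinc_zero]
    rcases mul_eq_zero.1 h with rfl | rfl
    · rw [powSer, tsum_eq_single 0 fun m hm => by simp [sincCoeff, hm]]
      simp [sincCoeff]
    · rw [zero_pow two_ne_zero, powSer_zero]
      simp [sincCoeff]
  · rw [Real.sinc_of_ne_zero h, ← ((Real.hasSum_sin (k * r)).div_const (k * r)).tsum_eq, powSer]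
    refine tsum_congr fun m => ?_
    rw [sincCoeff, neg_eq_neg_one_mul (k ^ 2), mul_pow (-1) (k ^ 2), pow_succ (k * r), pow_mul,
      mul_pow k r 2, mul_pow (k ^ 2) (r ^ 2)]
    obtain ⟨hk, hr⟩ := not_or.1 (mul_eq_zero.not.1 h)
    field_simp

theorem exists_isEntireProfile {d : ℕ} (hd : d = 2 ∨ d = 3) {k : ℝ} (hk : 0 < k) :
    ∃ G G1 G2 : ℝ → ℝ, IsEntireProfile d (k ^ 2) G G1 G2 ∧
      ∀ x y : EuclideanSpace ℝ (Fin d), imΦ k x y = G (‖x - y‖ ^ 2) := by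
  rcases hd with rfl | rfl
  · refine ⟨_, _, _, (isEntireCoeff_besselCoeff k).isEntireProfile 2 (k ^ 2) (1 / 4) fun m => ?_,
      fun x y => ?_⟩
    · push_cast
      linear_combination besselCoeff_succ k m
    · rw [imΦ_eq hk.ne', if_pos rfl, besselJ0_eq_powSer]
  · refine ⟨_, _, _, (isEntireCoeff_sincCoeff k).isEntireProfile 3 (k ^ 2) (k / (4 * Real.pi))
      fun m => ?_, fun x y => ?_⟩
    · push_cast
      linear_combination sincCoeff_succ k m
    · rw [imΦ_eq hk.ne', if_neg (by norm_num), sinc_eq_powSer]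

/-- The profile of the Green function in dimension two. -/
theorem exists_isFundamentalProfile_two {k : ℝ} (hk : 0 < k) :
    ∃ g g1 g2 : ℝ → ℂ, IsFundamentalProfile 2 (k ^ 2) g g1 g2 ∧
      ∀ x y : EuclideanSpace ℝ (Fin 2), x ≠ y → greenΦ k x y = g (‖x - y‖ ^ 2) := by
  have ha := isEntireCoeff_besselCoeff k
  have hb := isEntireCoeff_besselHarmonicCoeff k
  set A := powSer (besselCoeff k) with hA
  set A1 := powSer (derivCoeff (besselCoeff k)) with hA1
  set A2 := powSer (derivCoeff (derivCoeff (besselCoeff k))) with hA2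
  set B := powSer (besselHarmonicCoeff k) with hB
  set B1 := powSer (derivCoeff (besselHarmonicCoeff k)) with hB1
  set B2 := powSer (derivCoeff (derivCoeff (besselHarmonicCoeff k))) with hB2
  set c₀ := Real.log (k ^ 2 / 4) + 2 * Real.eulerMascheroniConstant with hc₀
  have hA0 : A 0 = 1 := by rw [hA, powSer_zero]; simp [besselCoeff]
  have hAd := ha.hasDerivAt
  have hA1d := ha.derivCoeff.hasDerivAt
  have hBd := hb.hasDerivAt
  have hB1d := hb.derivCoeff.hasDerivAt
  have hAc : Continuous A := ha.continuous
  have hA1c : Continuous A1 := ha.derivCoeff.continuous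
  have hA2c : Continuous A2 := ha.derivCoeff.derivCoeff.continuous
  have hBc : Continuous B := hb.continuous
  have hB1c : Continuous B1 := hb.derivCoeff.continuous
  have hB2c : Continuous B2 := hb.derivCoeff.derivCoeff.continuous
  have hAode : ∀ s, 4 * s * A2 s + 4 * A1 s + k ^ 2 * A s = 0 := fun s => by
    have h := ha.operator_eq 2 (k ^ 2) s
    have h0 : ∀ m : ℕ, (4 * m + 2 * 2) * ((m + 1) * besselCoeff k (m + 1)) + k ^ 2 * besselCoeff k m
        = 0 := fun m => by linear_combination besselCoeff_succ k m
    simp only [h0] at h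
    have h00 : powSer (fun _ => 0) s = 0 := by simp [powSer]
    rw [h00] at h
    linear_combination h
  -- Since harmonic (m + 1) = harmonic m + 1/(m + 1), the harmonic numbers leave the source 4 A'.
  -- The operator applied to log s · A leaves 8 A', which -2 B then cancels.
  have hBode : ∀ s, 4 * s * B2 s + 4 * B1 s + k ^ 2 * B s = 4 * A1 s := fun s => by
    have h := hb.operator_eq 2 (k ^ 2) s
    have h0 : ∀ m : ℕ, (4 * m + 2 * 2) * ((m + 1) * besselHarmonicCoeff k (m + 1))
        + k ^ 2 * besselHarmonicCoeff k m = 4 * derivCoeff (besselCoeff k) m := fun m => by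
      simp only [besselHarmonicCoeff, derivCoeff, harmonic_succ]
      push_cast
      have h1 := besselCoeff_succ k m
      have hm : (m : ℝ) + 1 ≠ 0 := by positivity
      field_simp
      linear_combination ((harmonic m : ℚ) : ℝ) * h1
    simp only [h0] at h
    have h4 : powSer (fun m => 4 * derivCoeff (besselCoeff k) m) s = 4 * A1 s := by
      rw [hA1, powSer, powSer, ← tsum_mul_left]
      exact tsum_congr fun m => by ring
    rw [h4] at h
    linear_combination h
  -- The real part of (i/4)(J₀ + i Y₀) is -Y₀/4, which gives the factor -1/(4π).
  set R : ℝ → ℝ := fun s => -(1 / (4 * Real.pi)) * ((Real.log s + c₀) * A s - 2 * B s) with hR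
  set R1 : ℝ → ℝ := fun s =>
    -(1 / (4 * Real.pi)) * (s⁻¹ * A s + (Real.log s + c₀) * A1 s - 2 * B1 s) with hR1
  set R2 : ℝ → ℝ := fun s => -(1 / (4 * Real.pi)) *
    (-(s ^ 2)⁻¹ * A s + s⁻¹ * A1 s + (s⁻¹ * A1 s + (Real.log s + c₀) * A2 s) - 2 * B2 s) with hR2
  have hRd : ∀ s, 0 < s → HasDerivAt R (R1 s) s := fun s hs =>
    (((((Real.hasDerivAt_log hs.ne').add_const c₀).mul (hAd s)).sub
      ((hBd s).const_mul 2)).const_mul _)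
  have hR1d : ∀ s, 0 < s → HasDerivAt R1 (R2 s) s := fun s hs =>
    ((((hasDerivAt_inv hs.ne').mul (hAd s)).add
      (((Real.hasDerivAt_log hs.ne').add_const c₀).mul (hA1d s))).sub
      ((hB1d s).const_mul 2)).const_mul _
  have hR2c : ContinuousOn R2 (Ioi 0) := by
    have hne : ∀ s ∈ Ioi (0 : ℝ), s ≠ 0 := fun s hs => (mem_Ioi.1 hs).ne'
    have hlog : ContinuousOn Real.log (Ioi (0 : ℝ)) := Real.continuousOn_log.mono hne
    have hinv : ContinuousOn (fun s : ℝ => s⁻¹) (Ioi (0 : ℝ)) := continuousOn_inv₀.mono hne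
    have hinv2 : ContinuousOn (fun s : ℝ => (s ^ 2)⁻¹) (Ioi (0 : ℝ)) :=
      (continuous_pow 2).continuousOn.inv₀ fun s hs => pow_ne_zero 2 (hne s hs)
    exact continuousOn_const.mul ((((hinv2.neg.mul hAc.continuousOn).add
      (hinv.mul hA1c.continuousOn)).add ((hinv.mul hA1c.continuousOn).add
      ((hlog.add continuousOn_const).mul hA2c.continuousOn))).sub
      (continuousOn_const.mul hB2c.continuousOn))
  have hRode : ∀ s, 0 < s → 4 * s * R2 s + 4 * R1 s + k ^ 2 * R s = 0 := fun s hs => by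
    simp only [hR, hR1, hR2]
    have hs' := hs.ne'
    have e1 := hAode s
    have e2 := hBode s
    have e3 : s * s⁻¹ = 1 := mul_inv_cancel₀ hs'
    have e4 : s * (s ^ 2)⁻¹ = s⁻¹ := by field_simp
    linear_combination (-(1 / (4 * Real.pi)) * (Real.log s + c₀)) * e1
      + (1 / (4 * Real.pi) * 2) * e2 - (1 / (4 * Real.pi)) * 8 * A1 s * e3
      + (1 / (4 * Real.pi)) * 4 * A s * e4
  have hslog : Tendsto (fun s : ℝ => s * Real.log s) (𝓝[>] 0) (𝓝 0) := by
    have := Real.continuous_mul_log.tendsto 0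
    rw [Real.log_zero, mul_zero] at this
    exact this.mono_left nhdsWithin_le_nhds
  have hid : Tendsto (fun s : ℝ => s) (𝓝[>] 0) (𝓝 0) := tendsto_id.mono_left nhdsWithin_le_nhds
  have hlim : ∀ {f : ℝ → ℝ}, Continuous f → Tendsto f (𝓝[>] 0) (𝓝 (f 0)) := fun hf =>
    (hf.tendsto 0).mono_left nhdsWithin_le_nhds
  have hRlim : Tendsto (fun s => s * R s) (𝓝[>] 0) (𝓝 0) := by
    have := ((((hslog.add (hid.mul_const c₀)).mul (hlim hAc)).sub
      ((hid.mul (hlim hBc)).const_mul 2)).const_mul (-(1 / (4 * Real.pi))))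
    simp only [zero_mul, add_zero, mul_zero, sub_zero] at this
    refine this.congr fun s => ?_
    simp only [hR]
    ring
  -- Only the term s⁻¹ A(s) survives multiplication by s, and A(0) = 1.
  have hR1lim : Tendsto (fun s => s * R1 s) (𝓝[>] 0) (𝓝 (-(1 / (4 * Real.pi)))) := by
    have := (((hlim hAc).add (((hslog.add (hid.mul_const c₀)).mul (hlim hA1c)))).sub
      ((hid.mul (hlim hB1c)).const_mul 2)).const_mul (-(1 / (4 * Real.pi)))
    simp only [zero_mul, add_zero, mul_zero, sub_zero, hA0, mul_one] at this
    refine this.congr' ?_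
    filter_upwards [self_mem_nhdsWithin] with s hs
    have hs' : s ≠ 0 := (mem_Ioi.1 hs).ne'
    simp only [hR1]
    field_simp
  have hsq : ∀ f : ℝ → ℂ, (fun s : ℝ => (s : ℂ) * f s) =ᶠ[𝓝[>] 0] fun s => (√s : ℂ) ^ 2 * f s := by
    intro f
    filter_upwards [self_mem_nhdsWithin] with s hs
    rw [← Complex.ofReal_pow, Real.sq_sqrt (mem_Ioi.1 hs).le]
  refine ⟨fun s => (R s : ℂ) + Complex.I / 4 * (A s : ℂ),
    fun s => (R1 s : ℂ) + Complex.I / 4 * (A1 s : ℂ),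
    fun s => (R2 s : ℂ) + Complex.I / 4 * (A2 s : ℂ), ⟨fun s hs => ?_, fun s hs => ?_, ?_,
      fun s hs => ?_, ?_, ?_⟩, fun x y hxy => ?_⟩
  · exact (hRd s hs).ofReal_comp.add ((hAd s).ofReal_comp.const_mul _)
  · exact (hR1d s hs).ofReal_comp.add ((hA1d s).ofReal_comp.const_mul _)
  · exact (Complex.continuous_ofReal.comp_continuousOn hR2c).add
      (continuousOn_const.mul (Complex.continuous_ofReal.comp hA2c).continuousOn)
  · have e1 : (4 * s * R2 s + 4 * R1 s + k ^ 2 * R s : ℂ) = 0 := by exact_mod_cast hRode s hs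
    have e2 : (4 * s * A2 s + 4 * A1 s + k ^ 2 * A s : ℂ) = 0 := by exact_mod_cast hAode s
    push_cast
    linear_combination e1 + Complex.I / 4 * e2
  · refine Tendsto.congr' (hsq _) ?_
    have h1 : Tendsto (fun s => ((s * R s : ℝ) : ℂ)) (𝓝[>] 0) (𝓝 ((0 : ℝ) : ℂ)) :=
      (Complex.continuous_ofReal.tendsto 0).comp hRlim
    have h2 : Tendsto (fun s => ((s * A s : ℝ) : ℂ)) (𝓝[>] 0) (𝓝 ((0 * A 0 : ℝ) : ℂ)) :=
      (Complex.continuous_ofReal.tendsto _).comp (hid.mul (hlim hAc))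
    have h := h1.add (h2.const_mul (Complex.I / 4))
    simp only [zero_mul, Complex.ofReal_zero, mul_zero, add_zero] at h
    refine h.congr fun s => ?_
    push_cast
    ring
  · refine Tendsto.congr' (hsq _) ?_
    have h1 : Tendsto (fun s => ((s * R1 s : ℝ) : ℂ)) (𝓝[>] 0)
        (𝓝 ((-(1 / (4 * Real.pi)) : ℝ) : ℂ)) :=
      (Complex.continuous_ofReal.tendsto _).comp hR1lim
    have h2 : Tendsto (fun s => ((s * A1 s : ℝ) : ℂ)) (𝓝[>] 0) (𝓝 ((0 * A1 0 : ℝ) : ℂ)) :=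
      (Complex.continuous_ofReal.tendsto _).comp (hid.mul (hlim hA1c))
    have h := h1.add (h2.const_mul (Complex.I / 4))
    -- With V = π the required constant 1/(2 · 2 · V) is 1/(4π).
    have hv : (volume : Measure (EuclideanSpace ℝ (Fin 2))).real (ball 0 1) = Real.pi := by
      rw [Measure.real, EuclideanSpace.volume_ball_fin_two]
      simp [Real.pi_pos.le]
    rw [hv]
    simp only [zero_mul, Complex.ofReal_zero, mul_zero, add_zero] at h
    convert! h using 1
    · funext s
      push_cast
      ring
    · push_cast
      congr 1
      ring
  · have hr : 0 < ‖x - y‖ := norm_pos_iff.2 (sub_ne_zero.2 hxy)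
    rw [greenΦ, if_pos rfl, hankelH10, besselJ0_eq_powSer, besselY0_eq_powSer hk hr]
    simp only [hR, hA, hB, hc₀]
    push_cast
    have hpi : (Real.pi : ℂ) ≠ 0 := by exact_mod_cast Real.pi_ne_zero
    field_simp
    ring_nf
    rw [Complex.I_sq]
    ring

/-- The profile of the Green function in dimension three. -/
theorem exists_isFundamentalProfile_three (k : ℝ) :
    ∃ g g1 g2 : ℝ → ℂ, IsFundamentalProfile 3 (k ^ 2) g g1 g2 ∧
      ∀ x y : EuclideanSpace ℝ (Fin 3), x ≠ y → greenΦ k x y = g (‖x - y‖ ^ 2) := by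
  have hpi : (Real.pi : ℂ) ≠ 0 := by exact_mod_cast Real.pi_ne_zero
  set e : ℝ → ℂ := fun r => Complex.exp (Complex.I * k * r) with he
  have hed : ∀ r : ℝ, HasDerivAt e (Complex.I * k * e r) r := fun r => by
    have h1 : HasDerivAt (fun r : ℝ => Complex.I * k * (r : ℂ)) (Complex.I * k * 1) r :=
      (Complex.ofRealCLM.hasDerivAt (x := r)).const_mul _
    rw [mul_one] at h1
    rw [mul_comm (Complex.I * k) (e r)]
    exact h1.cexp
  have hec : Continuous e := by fun_prop
  have hsqd : ∀ s : ℝ, 0 < s → HasDerivAt (fun s => √s) (1 / (2 * √s)) s := fun s hs =>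
    Real.hasDerivAt_sqrt hs.ne'
  -- In terms of r = √s one has d/ds = (1/(2r)) d/dr; applying it twice to e^(ikr)/(4πr) gives g1
  -- and g2.
  set g : ℝ → ℂ := fun s => e √s / (4 * Real.pi * (√s : ℂ)) with hg
  set g1 : ℝ → ℂ := fun s => e √s * (Complex.I * k * √s - 1) / (8 * Real.pi * (√s : ℂ) ^ 3) with hg1
  set g2 : ℝ → ℂ := fun s =>
    e √s * (3 - 3 * Complex.I * k * √s - k ^ 2 * (√s : ℂ) ^ 2) / (16 * Real.pi * (√s : ℂ) ^ 5) with hg2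
  have hid : ∀ r : ℝ, HasDerivAt (fun r : ℝ => (r : ℂ)) 1 r := fun r =>
    Complex.ofRealCLM.hasDerivAt (x := r)
  have hlim0 : Tendsto (fun s : ℝ => √s) (𝓝[>] 0) (𝓝 0) := by
    have := Real.continuous_sqrt.tendsto 0
    rw [Real.sqrt_zero] at this
    exact this.mono_left nhdsWithin_le_nhds
  refine ⟨g, g1, g2, ⟨fun s hs => ?_, fun s hs => ?_, ?_, fun s hs => ?_, ?_, ?_⟩, fun x y hxy => ?_⟩
  · have hr : 0 < √s := Real.sqrt_pos.2 hs
    have hrc : (√s : ℂ) ≠ 0 := by exact_mod_cast hr.ne'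
    have h := (hed √s).div ((hid √s).const_mul (4 * Real.pi : ℂ)) (by simp [hpi, hr.ne'])
    convert! h.scomp s (hsqd s hs) using 1
    simp only [hg1, Complex.real_smul]
    push_cast
    field_simp
    ring
  · have hr : 0 < √s := Real.sqrt_pos.2 hs
    have hrc : (√s : ℂ) ≠ 0 := by exact_mod_cast hr.ne'
    have h := ((hed √s).mul (((hid √s).const_mul (Complex.I * k)).sub_const 1)).div
      (((hid √s).pow 3).const_mul (8 * Real.pi : ℂ)) (by simp [hpi, hr.ne'])
    convert! h.scomp s (hsqd s hs) using 1
    simp only [hg2, Complex.real_smul, Pi.mul_apply, Pi.pow_apply]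
    push_cast
    field_simp
    ring_nf
    rw [Complex.I_sq]
    ring
  · have hc : Continuous fun s : ℝ =>
        e √s * (3 - 3 * Complex.I * k * √s - k ^ 2 * (√s : ℂ) ^ 2) := by fun_prop
    have hc2 : Continuous fun s : ℝ => 16 * Real.pi * (√s : ℂ) ^ 5 := by fun_prop
    refine hc.continuousOn.div hc2.continuousOn fun s hs => ?_
    have hr : 0 < √s := Real.sqrt_pos.2 hs
    simp [hpi, hr.ne']
  · have hr : 0 < √s := Real.sqrt_pos.2 hs
    have hrc : (√s : ℂ) ≠ 0 := by exact_mod_cast hr.ne'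
    have hs2 : (s : ℂ) = (√s : ℂ) ^ 2 := by
      rw [← Complex.ofReal_pow, Real.sq_sqrt hs.le]
    simp only [hg, hg1, hg2]
    rw [hs2]
    push_cast
    field_simp
    ring
  · have hc : Continuous fun r : ℝ => (r : ℂ) ^ 2 * e r / (4 * Real.pi) := by fun_prop
    have h := (hc.tendsto 0).comp hlim0
    simp only [Complex.ofReal_zero, ne_eq, OfNat.ofNat_ne_zero, not_false_eq_true, zero_pow,
      zero_mul, zero_div] at h
    refine h.congr' ?_
    filter_upwards [self_mem_nhdsWithin] with s hs
    have hrc : (√s : ℂ) ≠ 0 := by exact_mod_cast (Real.sqrt_pos.2 hs).ne'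
    simp only [Function.comp_apply, hg]
    field_simp
  · have hc : Continuous fun r : ℝ => e r * (Complex.I * k * r - 1) / (8 * Real.pi) := by fun_prop
    have h := (hc.tendsto 0).comp hlim0
    -- With V = 4π/3 the required constant 1/(2 · 3 · V) is 1/(8π).
    have hv : (volume : Measure (EuclideanSpace ℝ (Fin 3))).real (ball 0 1) = Real.pi * 4 / 3 := by
      rw [Measure.real, EuclideanSpace.volume_ball_fin_three]
      simp
      positivity
    rw [hv]
    have hval : e 0 * (Complex.I * k * ((0 : ℝ) : ℂ) - 1) / (8 * Real.pi)
        = -((1 / (2 * ((3 : ℕ) : ℝ) * (Real.pi * 4 / 3)) : ℝ) : ℂ) := by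
      simp only [he]
      push_cast
      rw [mul_zero, Complex.exp_zero]
      field_simp
      norm_num
    rw [hval] at h
    refine h.congr' ?_
    filter_upwards [self_mem_nhdsWithin] with s hs
    have hrc : (√s : ℂ) ≠ 0 := by exact_mod_cast (Real.sqrt_pos.2 hs).ne'
    simp only [Function.comp_apply, hg1]
    field_simp
  · rw [greenΦ, if_neg (by norm_num)]
    simp only [hg, he]
    rw [Real.sqrt_sq (norm_nonneg _)]
    push_cast
    rw [mul_assoc Complex.I]

theorem exists_isFundamentalProfile {d : ℕ} (hd : d = 2 ∨ d = 3) {k : ℝ} (hk : 0 < k) :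
    ∃ g g1 g2 : ℝ → ℂ, IsFundamentalProfile d (k ^ 2) g g1 g2 ∧
      ∀ x y : EuclideanSpace ℝ (Fin d), x ≠ y → greenΦ k x y = g (‖x - y‖ ^ 2) := by
  rcases hd with rfl | rfl
  · exact exists_isFundamentalProfile_two hk
  · exact exists_isFundamentalProfile_three k

/-! ### Green's second identity -/

section Green

variable {d : ℕ} {Ω : Set (EuclideanSpace ℝ (Fin d))}

/-- The Laplacian as the sum of the iterated partial derivatives. -/
def lap (f : EuclideanSpace ℝ (Fin d) → ℂ) (x : EuclideanSpace ℝ (Fin d)) : ℂ :=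
  ∑ i, fderiv ℝ (fun y => fderiv ℝ f y (EuclideanSpace.basisFun (Fin d) ℝ i)) x
    (EuclideanSpace.basisFun (Fin d) ℝ i)

/-- Green's second identity in a regular bounded domain. -/
theorem IsRegularBoundedDomain.green_identity (hΩ : IsRegularBoundedDomain Ω)
    {v w : EuclideanSpace ℝ (Fin d) → ℂ} (hv : ContDiff ℝ 1 v)
    (hv' : ∀ h, ContDiff ℝ 1 fun x => fderiv ℝ v x h) (hw : ContDiff ℝ 1 w)
    (hw' : ∀ h, ContDiff ℝ 1 fun x => fderiv ℝ w x h) :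
    ∫ y, (normalDeriv Ω v y * w y - v y * normalDeriv Ω w y) ∂(surfaceMeasure Ω)
      = ∫ y in Ω, (lap v y * w y - v y * lap w y) := by
  set b := EuclideanSpace.basisFun (Fin d) ℝ with hb
  -- The components of the field w ∇v - v ∇w; in its divergence the products of first derivatives
  -- cancel.
  set f : Fin d → EuclideanSpace ℝ (Fin d) → ℂ := fun i x =>
    fderiv ℝ v x (b i) * w x - v x * fderiv ℝ w x (b i) with hf
  have hfc : ∀ i, ContDiff ℝ 1 (f i) := fun i => ((hv' _).mul hw).sub (hv.mul (hw' _))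
  have hν := continuousOn_outwardNormal hΩ.isOpen hΩ.hasC1Boundary
  have hdiv := fun i => hΩ.setIntegral_fderiv (b i) (hfc i)
  have hfd : ∀ i x, fderiv ℝ (f i) x (b i)
      = fderiv ℝ (fun y => fderiv ℝ v y (b i)) x (b i) * w x
        - v x * fderiv ℝ (fun y => fderiv ℝ w y (b i)) x (b i) := fun i x => by
    have h1 := ((hv' (b i)).differentiable one_ne_zero x).hasFDerivAt
    have h2 := ((hw' (b i)).differentiable one_ne_zero x).hasFDerivAt
    have h3 := (hv.differentiable one_ne_zero x).hasFDerivAt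
    have h4 := (hw.differentiable one_ne_zero x).hasFDerivAt
    rw [show fderiv ℝ (f i) x = _ from ((h1.mul h4).sub (h3.mul h2)).fderiv]
    simp only [_root_.sub_apply, _root_.add_apply,
      _root_.smul_apply, smul_eq_mul]
    ring
  have hleft : ∀ y, lap v y * w y - v y * lap w y = ∑ i, fderiv ℝ (f i) y (b i) := fun y => by
    simp only [lap, ← hb, hfd, Finset.sum_sub_distrib, Finset.sum_mul, Finset.mul_sum]
  have hexp : ∀ (L : EuclideanSpace ℝ (Fin d) →L[ℝ] ℂ) (n : EuclideanSpace ℝ (Fin d)),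
      L n = ∑ i, (⟪n, b i⟫_ℝ : ℂ) * L (b i) := fun L n => by
    conv_lhs => rw [← b.sum_repr n, map_sum]
    refine Finset.sum_congr rfl fun i _ => ?_
    rw [map_smul, b.repr_apply_apply, real_inner_comm, Complex.real_smul]
  have hright : ∀ y, normalDeriv Ω v y * w y - v y * normalDeriv Ω w y
      = ∑ i, ⟪outwardNormal Ω y, b i⟫_ℝ • f i y := fun y => by
    rw [normalDeriv, normalDeriv, hexp (fderiv ℝ v y), hexp (fderiv ℝ w y), Finset.sum_mul,
      Finset.mul_sum, ← Finset.sum_sub_distrib]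
    refine Finset.sum_congr rfl fun i _ => ?_
    simp only [hf, Complex.real_smul]
    ring
  simp_rw [hleft, hright]
  rw [integral_finsetSum, integral_finsetSum]
  · exact Finset.sum_congr rfl fun i _ => (hdiv i).symm
  · exact fun i _ => hΩ.integrableOn
      (((hfc i).continuous_fderiv one_ne_zero).clm_apply continuous_const).continuousOn
  · intro i _
    have hνi : ContinuousOn (fun y => ⟪outwardNormal Ω y, b i⟫_ℝ) (frontier Ω) :=
      hν.inner continuousOn_const
    exact hΩ.integrable_surfaceMeasure (hνi.smul (hfc i).continuous.continuousOn)

end Green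

/-! ### Radial functions -/

section Radial

variable {E F : Type*} [NormedAddCommGroup E] [InnerProductSpace ℝ E] [NormedAddCommGroup F]
  [NormedSpace ℝ F]

/-- The shift c serves both uses: c = 0 for the actual kernels, c = ε² > 0 for the regularized ones,
whose argument never reaches 0. -/
theorem hasFDerivAt_radial {h : ℝ → F} {h' : F} (a : E) (c : ℝ) {x : E}
    (hh : HasDerivAt h h' (‖x - a‖ ^ 2 + c)) :
    HasFDerivAt (fun y => h (‖y - a‖ ^ 2 + c)) ((2 • innerSL ℝ (x - a)).smulRight h') x := by
  have h1 : HasFDerivAt (fun y : E => ‖y - a‖ ^ 2 + c) (2 • innerSL ℝ (x - a)) x := by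
    have := ((hasFDerivAt_id x).sub_const a).norm_sq.add_const c
    simpa using this
  have h2 := hh.hasFDerivAt.comp x h1
  convert! h2 using 1

theorem fderiv_radial_apply {h : ℝ → F} {h' : F} (a : E) (c : ℝ) {x : E}
    (hh : HasDerivAt h h' (‖x - a‖ ^ 2 + c)) (w : E) :
    fderiv ℝ (fun y => h (‖y - a‖ ^ 2 + c)) x w = (2 * ⟪x - a, w⟫_ℝ) • h' := by
  rw [(hasFDerivAt_radial a c hh).fderiv]
  simp [inner_sub_left]

theorem contDiff_radial {h h' : ℝ → F} (a : E) (c : ℝ)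
    (hh : ∀ x : E, HasDerivAt h (h' (‖x - a‖ ^ 2 + c)) (‖x - a‖ ^ 2 + c))
    (hc : Continuous fun x : E => h' (‖x - a‖ ^ 2 + c)) :
    ContDiff ℝ 1 fun x : E => h (‖x - a‖ ^ 2 + c) := by
  refine contDiff_one_iff_hasFDerivAt.2 ⟨_, ?_, fun x => hasFDerivAt_radial a c (hh x)⟩
  have h1 : Continuous fun x : E => (2 : ℕ) • innerSL ℝ (x - a) := by fun_prop
  exact (ContinuousLinearMap.smulRightL ℝ E F).continuous₂.comp (h1.prodMk hc)

theorem continuous_radial {h h' : ℝ → F} (a : E) (c : ℝ)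
    (hh : ∀ x : E, HasDerivAt h (h' (‖x - a‖ ^ 2 + c)) (‖x - a‖ ^ 2 + c)) :
    Continuous fun x : E => h (‖x - a‖ ^ 2 + c) :=
  continuous_iff_continuousAt.2 fun x => (hasFDerivAt_radial a c (hh x)).continuousAt

variable {d : ℕ} {h h1 h2 : ℝ → ℂ} {a : EuclideanSpace ℝ (Fin d)} {c : ℝ}

theorem contDiff_fderiv_radial
    (hh : ∀ x, HasDerivAt h (h1 (‖x - a‖ ^ 2 + c)) (‖x - a‖ ^ 2 + c))
    (hh1 : ∀ x, HasDerivAt h1 (h2 (‖x - a‖ ^ 2 + c)) (‖x - a‖ ^ 2 + c))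
    (hc : Continuous fun x => h2 (‖x - a‖ ^ 2 + c)) (w : EuclideanSpace ℝ (Fin d)) :
    ContDiff ℝ 1 fun x => fderiv ℝ (fun y => h (‖y - a‖ ^ 2 + c)) x w := by
  have heq : (fun x => fderiv ℝ (fun y => h (‖y - a‖ ^ 2 + c)) x w)
      = fun x => (2 * ⟪x - a, w⟫_ℝ) • h1 (‖x - a‖ ^ 2 + c) :=
    funext fun x => fderiv_radial_apply a c (hh x) w
  rw [heq]
  have hl : ContDiff ℝ 1 fun x : EuclideanSpace ℝ (Fin d) => 2 * ⟪x - a, w⟫_ℝ :=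
    contDiff_const.mul ((contDiff_id.sub contDiff_const).inner ℝ contDiff_const)
  exact hl.smul (contDiff_radial a c hh1 hc)

/-- Differentiating h twice brings down the squared components of x - a, which add up to |x - a|²
and not to |x - a|² + c. This mismatch with the radial equation yields the residual source -4c h2.
-/
theorem lap_radial
    (hh : ∀ x, HasDerivAt h (h1 (‖x - a‖ ^ 2 + c)) (‖x - a‖ ^ 2 + c))
    (hh1 : ∀ x, HasDerivAt h1 (h2 (‖x - a‖ ^ 2 + c)) (‖x - a‖ ^ 2 + c))
    (x : EuclideanSpace ℝ (Fin d)) :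
    lap (fun y => h (‖y - a‖ ^ 2 + c)) x
      = 2 * d * h1 (‖x - a‖ ^ 2 + c) + 4 * (‖x - a‖ ^ 2 : ℝ) * h2 (‖x - a‖ ^ 2 + c) := by
  set b := EuclideanSpace.basisFun (Fin d) ℝ with hb
  have hterm : ∀ i, fderiv ℝ (fun y => fderiv ℝ (fun y => h (‖y - a‖ ^ 2 + c)) y (b i)) x (b i)
      = 2 * h1 (‖x - a‖ ^ 2 + c)
        + 4 * ((⟪x - a, b i⟫_ℝ * ⟪b i, x - a⟫_ℝ : ℝ) : ℂ) * h2 (‖x - a‖ ^ 2 + c) := fun i => by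
    have heq : (fun y => fderiv ℝ (fun y => h (‖y - a‖ ^ 2 + c)) y (b i))
        = fun y => (2 * ⟪y - a, b i⟫_ℝ) • h1 (‖y - a‖ ^ 2 + c) :=
      funext fun y => fderiv_radial_apply a c (hh y) _
    rw [heq]
    have hl : HasFDerivAt (fun y : EuclideanSpace ℝ (Fin d) => 2 * ⟪y - a, b i⟫_ℝ)
        ((2 : ℝ) • innerSL ℝ (b i)) x := by
      have h0 : (fun y : EuclideanSpace ℝ (Fin d) => 2 * ⟪y - a, b i⟫_ℝ)
          = fun y => (2 : ℝ) • (innerSL ℝ (b i)) (y - a) := by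
        funext y
        rw [innerSL_apply_apply, real_inner_comm, smul_eq_mul]
      rw [h0]
      have h1 := ((innerSL ℝ (b i)).hasFDerivAt (x := x - a)).comp x
        ((hasFDerivAt_id x).sub_const a)
      exact h1.const_smul (2 : ℝ)
    rw [show fderiv ℝ (fun y => (2 * ⟪y - a, b i⟫_ℝ) • h1 (‖y - a‖ ^ 2 + c)) x = _ from
      (hl.smul (hasFDerivAt_radial a c (hh1 x))).fderiv]
    have hbb : ⟪b i, b i⟫_ℝ = 1 := by rw [real_inner_self_eq_norm_sq, b.norm_eq_one, one_pow]
    simp only [_root_.add_apply, _root_.smul_apply,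
      ContinuousLinearMap.smulRight_apply, innerSL_apply_apply, hbb, Complex.real_smul,
      real_inner_comm (x - a) (b i), smul_eq_mul, nsmul_eq_mul]
    push_cast
    ring
  rw [lap]
  simp only [← hb, hterm]
  rw [Finset.sum_add_distrib, Finset.sum_const, ← Finset.sum_mul, ← Finset.mul_sum,
    ← Complex.ofReal_sum, b.sum_inner_mul_inner, real_inner_self_eq_norm_sq]
  simp
  ring

end Radial

/-! ### The approximation of the Dirac mass -/

section Dirac

/-- It makes (r/√(1 + r²))^d / d a primitive of the radial density r^(d-1) (1 + r²)^(-(d+2)/2). -/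
theorem hasDerivAt_div_sqrt_one_add_sq (r : ℝ) :
    HasDerivAt (fun r : ℝ => r / √(1 + r ^ 2)) ((√(1 + r ^ 2) ^ 3)⁻¹) r := by
  have hpos : 0 < 1 + r ^ 2 := by positivity
  have hs : 0 < √(1 + r ^ 2) := Real.sqrt_pos.2 hpos
  have h1 : HasDerivAt (fun r : ℝ => 1 + r ^ 2) (2 * r) r := by
    simpa using (hasDerivAt_pow 2 r).const_add 1
  have h2 := (hasDerivAt_id r).div (h1.sqrt hpos.ne') hs.ne'
  convert! h2 using 1
  have hsq : √(1 + r ^ 2) ^ 2 = 1 + r ^ 2 := Real.sq_sqrt hpos.le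
  simp only [id_eq]
  field_simp
  rw [hsq]
  ring

theorem tendsto_div_sqrt_one_add_sq : Tendsto (fun r : ℝ => r / √(1 + r ^ 2)) atTop (𝓝 1) := by
  have h1 : Tendsto (fun r : ℝ => (√((r⁻¹) ^ 2 + 1))⁻¹) atTop (𝓝 1) := by
    have hc : Continuous fun t : ℝ => (√(t ^ 2 + 1))⁻¹ := by
      refine Continuous.inv₀ (by fun_prop) fun t => ?_
      have : 0 < t ^ 2 + 1 := by positivity
      exact (Real.sqrt_pos.2 this).ne'
    have := (hc.tendsto 0).comp tendsto_inv_atTop_zero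
    simpa [Function.comp_def] using this
  refine h1.congr' ?_
  filter_upwards [eventually_gt_atTop 0] with r hr
  have : √(1 + r ^ 2) = r * √((r⁻¹) ^ 2 + 1) := by
    rw [← Real.sqrt_sq hr.le, ← Real.sqrt_mul (by positivity), Real.sqrt_sq hr.le]
    congr 1
    field_simp
  rw [this, div_mul_eq_div_div, div_self hr.ne', one_div]

variable {d : ℕ}

/-- The kernel `(1 + |y|²)^{-(d+2)/2}`. -/
def diracKernel (y : EuclideanSpace ℝ (Fin d)) : ℝ := (√(1 + ‖y‖ ^ 2) ^ (d + 2))⁻¹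

theorem integrable_diracKernel : Integrable (diracKernel (d := d)) := by
  have h := integrable_rpow_neg_one_add_norm_sq (E := EuclideanSpace ℝ (Fin d)) (μ := volume)
    (r := (d : ℝ) + 2) (by rw [finrank_euclideanSpace_fin]; linarith)
  refine h.congr (ae_of_all _ fun y => ?_)
  have hpos : (0 : ℝ) ≤ 1 + ‖y‖ ^ 2 := by positivity
  simp only [diracKernel]
  rw [neg_div, Real.rpow_neg hpos, Real.sqrt_eq_rpow, ← Real.rpow_natCast (_ ^ (1 / 2 : ℝ)), ← Real.rpow_mul hpos]
  congr 2
  push_cast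
  ring

/-- In polar coordinates the integral is d V times the radial one, and the latter equals 1/d by an
explicit primitive. -/
theorem integral_diracKernel (hd : 0 < d) :
    ∫ y, diracKernel (d := d) y
      = (volume : Measure (EuclideanSpace ℝ (Fin d))).real (ball 0 1) := by
  have : Nonempty (Fin d) := ⟨⟨0, hd⟩⟩
  have hd' : (d : ℝ) ≠ 0 := by exact_mod_cast hd.ne'
  have h := integral_fun_norm_addHaar (volume : Measure (EuclideanSpace ℝ (Fin d)))
    (fun r : ℝ => (√(1 + r ^ 2) ^ (d + 2))⁻¹)
  have hI : ∫ r in Ioi (0 : ℝ), r ^ (d - 1) • (√(1 + r ^ 2) ^ (d + 2))⁻¹ = 1 / d := by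
    have hder : ∀ r ∈ Ici (0 : ℝ), HasDerivAt (fun r : ℝ => (r / √(1 + r ^ 2)) ^ d / d)
        (r ^ (d - 1) • (√(1 + r ^ 2) ^ (d + 2))⁻¹) r := fun r _ => by
      have h1 := ((hasDerivAt_div_sqrt_one_add_sq r).pow d).div_const (d : ℝ)
      convert! h1 using 1
      have hs : √(1 + r ^ 2) ≠ 0 := (Real.sqrt_pos.2 (by positivity)).ne'
      rw [smul_eq_mul, div_pow, show d + 2 = d - 1 + 3 by omega, pow_add]
      field_simp
    have hlim : Tendsto (fun r : ℝ => (r / √(1 + r ^ 2)) ^ d / d) atTop (𝓝 (1 / d)) := by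
      simpa using (tendsto_div_sqrt_one_add_sq.pow d).div_const (d : ℝ)
    rw [integral_Ioi_of_hasDerivAt_of_nonneg' hder (fun r hr => ?_) hlim]
    · simp [hd.ne']
    · have : 0 < r := hr
      rw [smul_eq_mul]
      positivity
  rw [finrank_euclideanSpace_fin, hI] at h
  simp only [diracKernel]
  rw [h, nsmul_eq_mul, smul_eq_mul]
  field_simp

variable {K : ℝ} {g g1 g2 : ℝ → ℂ}

/-- Multiplying the radial equation by s^(d/2) expresses 4 s^((d+2)/2) g2 through s^(d/2) g1 and
s^(d/2) g; the first contributes 2d/(2dV) = 1/V in the limit, the second nothing. -/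
theorem IsFundamentalProfile.tendsto_second (hg : IsFundamentalProfile d K g g1 g2) (hd : 0 < d) :
    Tendsto (fun s : ℝ => (√s : ℂ) ^ (d + 2) * g2 s) (𝓝[>] 0)
      (𝓝 ((1 / (4 * (volume : Measure (EuclideanSpace ℝ (Fin d))).real (ball 0 1)) : ℝ))) := by
  have hd' : (d : ℂ) ≠ 0 := by exact_mod_cast hd.ne'
  have h := (hg.tendsto_deriv.const_mul (-(d / 2 : ℂ))).sub
    (hg.tendsto_zero.const_mul ((K : ℂ) / 4))
  rw [mul_zero, sub_zero] at h
  convert! h.congr' ?_ using 2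
  · push_cast
    field_simp
    norm_num
  · filter_upwards [self_mem_nhdsWithin] with s hs
    have hs2 : (√s : ℂ) ^ 2 = s := by rw [← Complex.ofReal_pow, Real.sq_sqrt (mem_Ioi.1 hs).le]
    rw [pow_add, hs2]
    linear_combination (-(√s : ℂ) ^ d / 4) * hg.ode s hs

/-- The limit at 0 controls an initial interval and continuity the compact rest. The bound provides
the dominating function for the Dirac limit. -/
theorem IsFundamentalProfile.exists_bound_second (hg : IsFundamentalProfile d K g g1 g2)
    (hd : 0 < d) (M : ℝ) :
    ∃ C, ∀ s ∈ Ioc 0 M, ‖(√s : ℂ) ^ (d + 2) * g2 s‖ ≤ C := by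
  have h := (hg.tendsto_second hd).norm
  have hev := h.eventually (gt_mem_nhds (lt_add_one _))
  obtain ⟨δ, hδ, hδ2⟩ := mem_nhdsGT_iff_exists_Ioo_subset.1 hev
  have hcont : ContinuousOn (fun s : ℝ => (√s : ℂ) ^ (d + 2) * g2 s) (Icc δ M) := by
    have hc : Continuous fun s : ℝ => (√s : ℂ) ^ (d + 2) := by fun_prop
    exact hc.continuousOn.mul (hg.continuousOn.mono fun s hs => lt_of_lt_of_le hδ hs.1)
  obtain ⟨C, hC⟩ := isCompact_Icc.exists_bound_of_continuousOn hcont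
  refine ⟨max C (‖((1 / (4 * (volume : Measure (EuclideanSpace ℝ (Fin d))).real (ball 0 1)) : ℝ) : ℂ)‖
    + 1), fun s hs => ?_⟩
  by_cases hsδ : s < δ
  · exact le_max_of_le_right (le_of_lt (hδ2 ⟨hs.1, hsδ⟩))
  · exact le_max_of_le_left (hC s ⟨not_lt.1 hsδ, hs.2⟩)

/-- The functions `4 ε² g''(|x - y|² + ε²)` approximate the Dirac mass at `y` as `ε → 0`. -/
theorem IsFundamentalProfile.tendsto_setIntegral (hg : IsFundamentalProfile d K g g1 g2)
    (hd : 0 < d) {Ω : Set (EuclideanSpace ℝ (Fin d))} (ho : IsOpen Ω)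
    (hb : Bornology.IsBounded Ω) {v : EuclideanSpace ℝ (Fin d) → ℂ} (hv : Continuous v)
    {y₀ : EuclideanSpace ℝ (Fin d)} (hy₀ : y₀ ∈ Ω) :
    Tendsto (fun ε : ℝ => ∫ x in Ω, v x * (4 * (ε : ℂ) ^ 2 * g2 (‖x - y₀‖ ^ 2 + ε ^ 2)))
      (𝓝[>] 0) (𝓝 (v y₀)) := by
  classical
  set V := (volume : Measure (EuclideanSpace ℝ (Fin d))).real (ball 0 1) with hV
  have hV0 : 0 < V := ENNReal.toReal_pos (measure_ball_pos _ _ one_pos).ne' measure_ball_lt_top.ne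
  set H : ℝ → ℂ := fun s => (√s : ℂ) ^ (d + 2) * g2 s with hH
  set Q : ℝ → EuclideanSpace ℝ (Fin d) → ℂ := fun ε y =>
    Ω.indicator (fun x => v x) (y₀ + ε • y) * (4 * diracKernel y * H (ε ^ 2 * (1 + ‖y‖ ^ 2))) with hQ
  -- Substituting x = y₀ + ε y gives √s = ε √(1 + |y|²); the Jacobian ε^d and the factor ε² combine
  -- to exactly the power that turns g2 into H times the kernel.
  have hchange : ∀ ε : ℝ, 0 < ε →
      ∫ y, Q ε y = ∫ x in Ω, v x * (4 * (ε : ℂ) ^ 2 * g2 (‖x - y₀‖ ^ 2 + ε ^ 2)) := by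
    intro ε hε
    rw [← integral_indicator ho.measurableSet]
    set f : EuclideanSpace ℝ (Fin d) → ℂ :=
      Ω.indicator fun x => v x * (4 * (ε : ℂ) ^ 2 * g2 (‖x - y₀‖ ^ 2 + ε ^ 2)) with hf
    rw [← integral_add_left_eq_self f y₀]
    have hscale := Measure.integral_comp_smul (volume : Measure (EuclideanSpace ℝ (Fin d)))
      (fun x => f (y₀ + x)) ε
    rw [finrank_euclideanSpace_fin, abs_of_pos (by positivity)] at hscale
    have hmul : ∀ I : ℂ, I = ((ε : ℂ) ^ d) * (((ε ^ d)⁻¹ : ℝ) • I) := fun I => by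
      have : (ε : ℂ) ≠ 0 := by exact_mod_cast hε.ne'
      rw [Complex.real_smul]
      push_cast
      field_simp
    rw [hmul (∫ x, f (y₀ + x)), ← hscale, ← integral_const_mul]
    congr 1 with y
    simp only [hQ, hf, indicator_apply]
    split_ifs with hy
    · have hnorm : ‖y₀ + ε • y - y₀‖ ^ 2 + ε ^ 2 = ε ^ 2 * (1 + ‖y‖ ^ 2) := by
        rw [add_sub_cancel_left, norm_smul, Real.norm_eq_abs, mul_pow, sq_abs]
        ring
      have hsqrt : √(ε ^ 2 * (1 + ‖y‖ ^ 2)) = ε * √(1 + ‖y‖ ^ 2) := by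
        rw [Real.sqrt_mul (by positivity), Real.sqrt_sq hε.le]
      have hs : (√(1 + ‖y‖ ^ 2) : ℂ) ≠ 0 := by
        exact_mod_cast (Real.sqrt_pos.2 (by positivity : (0 : ℝ) < 1 + ‖y‖ ^ 2)).ne'
      rw [hnorm]
      simp only [hH, diracKernel]
      rw [hsqrt]
      push_cast
      field_simp
      ring
    · simp
  obtain ⟨R, hR0, hR⟩ : ∃ R > 0, Ω ⊆ closedBall y₀ R := by
    obtain ⟨R, hR⟩ := hb.subset_closedBall y₀
    exact ⟨max R 1, by positivity, hR.trans (closedBall_subset_closedBall (le_max_left _ _))⟩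
  -- If y₀ + ε y lies in Ω and ε < 1, then ε² (1 + |y|²) ≤ R² + 1; for other y the indicator
  -- vanishes.
  obtain ⟨C, hC⟩ := hg.exists_bound_second hd (R ^ 2 + 1)
  obtain ⟨B, hB⟩ := (isCompact_closedBall y₀ R).exists_bound_of_continuousOn hv.continuousOn
  have hC0 : 0 ≤ C := (norm_nonneg _).trans (hC (R ^ 2 + 1) ⟨by positivity, le_rfl⟩)
  have hB0 : 0 ≤ B := (norm_nonneg _).trans (hB y₀ (mem_closedBall_self hR0.le))
  have hker : ∀ y : EuclideanSpace ℝ (Fin d), 0 ≤ diracKernel y := fun y => by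
    unfold diracKernel
    positivity
  have hpos : ∀ (ε : ℝ), 0 < ε → ∀ y : EuclideanSpace ℝ (Fin d), 0 < ε ^ 2 * (1 + ‖y‖ ^ 2) :=
    fun ε hε y => by positivity
  have hdct : Tendsto (fun ε => ∫ y, Q ε y) (𝓝[>] 0)
      (𝓝 (∫ y : EuclideanSpace ℝ (Fin d), v y₀ * (4 * diracKernel y * ((1 / (4 * V) : ℝ) : ℂ)))) := by
    refine tendsto_integral_filter_of_dominated_convergence
      (fun y => B * (4 * C) * diracKernel y) ?_ ?_ (integrable_diracKernel.const_mul _) ?_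
    · filter_upwards [self_mem_nhdsWithin] with ε hε
      have hm1 : Measurable (Ω.indicator fun x => v x) := hv.measurable.indicator ho.measurableSet
      have hm2 : Measurable fun y : EuclideanSpace ℝ (Fin d) => y₀ + ε • y := by fun_prop
      have hk : Continuous fun y : EuclideanSpace ℝ (Fin d) => diracKernel y := by
        unfold diracKernel
        refine Continuous.inv₀ (by fun_prop) fun y => ?_
        have := Real.sqrt_pos.2 (by positivity : (0 : ℝ) < 1 + ‖y‖ ^ 2)
        positivity
      have hc3 : Continuous fun y : EuclideanSpace ℝ (Fin d) => H (ε ^ 2 * (1 + ‖y‖ ^ 2)) := by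
        have h1 : Continuous fun y : EuclideanSpace ℝ (Fin d) => ε ^ 2 * (1 + ‖y‖ ^ 2) := by
          fun_prop
        have h2 : ContinuousOn H (Ioi 0) := by
          have hc : Continuous fun s : ℝ => (√s : ℂ) ^ (d + 2) := by fun_prop
          exact hc.continuousOn.mul hg.continuousOn
        exact h2.comp_continuous h1 fun y => hpos ε hε y
      have hc4 : Continuous fun y : EuclideanSpace ℝ (Fin d) =>
          (4 * diracKernel y * H (ε ^ 2 * (1 + ‖y‖ ^ 2)) : ℂ) :=
        (continuous_const.mul (Complex.continuous_ofReal.comp hk)).mul hc3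
      exact ((hm1.comp hm2).mul hc4.measurable).aestronglyMeasurable
    · filter_upwards [Ioo_mem_nhdsGT one_pos] with ε hε
      refine ae_of_all _ fun y => ?_
      simp only [hQ, indicator_apply]
      split_ifs with hy
      · have hyR := hR hy
        have hle : ε ^ 2 * (1 + ‖y‖ ^ 2) ≤ R ^ 2 + 1 := by
          rw [mem_closedBall, dist_eq_norm, add_sub_cancel_left] at hyR
          have h1 : ‖ε • y‖ ^ 2 ≤ R ^ 2 := by gcongr
          rw [norm_smul, mul_pow, Real.norm_eq_abs, sq_abs] at h1
          nlinarith [hε.1, hε.2]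
        have h1 := hB _ (hR hy)
        have h2 := hC _ ⟨hpos ε hε.1 y, hle⟩
        rw [norm_mul, norm_mul, norm_mul, Complex.norm_real, Real.norm_of_nonneg (hker y)]
        calc ‖v (y₀ + ε • y)‖ * (‖(4 : ℂ)‖ * diracKernel y * ‖H (ε ^ 2 * (1 + ‖y‖ ^ 2))‖)
            ≤ B * (‖(4 : ℂ)‖ * diracKernel y * C) := by
              have := hker y
              gcongr
          _ = B * (4 * C) * diracKernel y := by
              simp
              ring
      · rw [zero_mul, norm_zero]
        have := hker y
        positivity
    · refine ae_of_all _ fun y => ?_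
      have hc : Continuous fun ε : ℝ => y₀ + ε • y := by fun_prop
      have ht : Tendsto (fun ε : ℝ => y₀ + ε • y) (𝓝[>] 0) (𝓝 y₀) := by
        simpa using (hc.tendsto 0).mono_left nhdsWithin_le_nhds
      have ht1 : Tendsto (fun ε : ℝ => Ω.indicator (fun x => v x) (y₀ + ε • y)) (𝓝[>] 0)
          (𝓝 (v y₀)) := by
        refine ((hv.tendsto y₀).comp ht).congr' ?_
        filter_upwards [ht.eventually (ho.mem_nhds hy₀)] with ε hε
        rw [indicator_of_mem hε]
        rfl
      have ht2 : Tendsto (fun ε : ℝ => ε ^ 2 * (1 + ‖y‖ ^ 2)) (𝓝[>] 0) (𝓝[>] 0) := by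
        refine tendsto_nhdsWithin_iff.2 ⟨?_, ?_⟩
        · have hc2 : Continuous fun ε : ℝ => ε ^ 2 * (1 + ‖y‖ ^ 2) := by fun_prop
          simpa using (hc2.tendsto 0).mono_left nhdsWithin_le_nhds
        · filter_upwards [self_mem_nhdsWithin] with ε hε
          exact hpos ε hε y
      exact ht1.mul (((hg.tendsto_second hd).comp ht2).const_mul _)
  -- The kernel has total mass V, so the limit is 4 · V · 1/(4V) = 1 times v y₀.
  have hval : ∫ y : EuclideanSpace ℝ (Fin d), v y₀ * (4 * diracKernel y * ((1 / (4 * V) : ℝ) : ℂ)) = v y₀ := by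
    have : ∀ y : EuclideanSpace ℝ (Fin d), v y₀ * (4 * diracKernel y * ((1 / (4 * V) : ℝ) : ℂ))
        = (v y₀ * (V : ℂ)⁻¹) * (diracKernel y : ℂ) := fun y => by
      push_cast
      field_simp
    simp_rw [this]
    rw [integral_const_mul, integral_complex_ofReal, integral_diracKernel hd, ← hV]
    have : (V : ℂ) ≠ 0 := by exact_mod_cast hV0.ne'
    field_simp
  rw [hval] at hdct
  refine hdct.congr' ?_
  filter_upwards [self_mem_nhdsWithin] with ε hε
  exact hchange ε hε

end Dirac

/-! ### The Green representation of the imaginary part of the Green function -/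

section Representation

variable {d : ℕ} {Ω : Set (EuclideanSpace ℝ (Fin d))}

/-- A function continuous on the compact set [0,1] × ∂Ω is bounded there, and the surface measure is
finite, so dominated convergence applies. -/
theorem IsRegularBoundedDomain.tendsto_integral_surfaceMeasure (hΩ : IsRegularBoundedDomain Ω)
    {I : ℝ → EuclideanSpace ℝ (Fin d) → ℂ}
    (hI : ContinuousOn (Function.uncurry I) (Icc 0 1 ×ˢ frontier Ω)) :
    Tendsto (fun c => ∫ y, I c y ∂(surfaceMeasure Ω)) (𝓝[>] 0)
      (𝓝 (∫ y, I 0 y ∂(surfaceMeasure Ω))) := by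
  have := hΩ.isFiniteMeasure_surfaceMeasure
  obtain ⟨C, hC⟩ := (isCompact_Icc.prod hΩ.isCompact_frontier).exists_bound_of_continuousOn hI
  have hev : ∀ᶠ c : ℝ in 𝓝[>] 0, c ∈ Icc (0 : ℝ) 1 := by
    filter_upwards [Ioo_mem_nhdsGT one_pos] with c hc
    exact ⟨hc.1.le, hc.2.le⟩
  have hae : ∀ᵐ y ∂(surfaceMeasure Ω), y ∈ frontier Ω :=
    ae_restrict_mem isClosed_frontier.measurableSet
  refine tendsto_integral_filter_of_dominated_convergence (fun _ => C) ?_ ?_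
    (integrable_const C) ?_
  · filter_upwards [hev] with c hc
    refine (hΩ.integrable_surfaceMeasure (f := I c) ?_).aestronglyMeasurable
    exact hI.comp (f := fun y => (c, y)) (by fun_prop) fun y hy => ⟨hc, hy⟩
  · filter_upwards [hev] with c hc
    filter_upwards [hae] with y hy
    exact hC (c, y) ⟨hc, hy⟩
  · filter_upwards [hae] with y hy
    have h1 : ContinuousOn (fun c => I c y) (Icc 0 1) :=
      hI.comp (f := fun c => (c, y)) (by fun_prop) fun c hc => ⟨hc, hy⟩
    have h2 := h1 0 ⟨le_rfl, zero_le_one⟩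
    exact h2.tendsto.mono_left (nhdsWithin_le_iff.2 hev)

variable {K : ℝ} {G G1 G2 : ℝ → ℝ} {g g1 g2 : ℝ → ℂ}

/-- The integrand of the boundary integral for the field `g(|x - y₀|² + c)`. -/
def boundaryIntegrand (Ω : Set (EuclideanSpace ℝ (Fin d))) (G G1 : ℝ → ℝ) (g g1 : ℝ → ℂ)
    (z y₀ : EuclideanSpace ℝ (Fin d)) (c : ℝ) (y : EuclideanSpace ℝ (Fin d)) : ℂ :=
  (2 * ⟪y - z, outwardNormal Ω y⟫_ℝ * G1 (‖y - z‖ ^ 2) : ℝ) * g (‖y - y₀‖ ^ 2 + c)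
    - (G (‖y - z‖ ^ 2) : ℂ) *
      ((2 * ⟪y - y₀, outwardNormal Ω y⟫_ℝ : ℝ) * g1 (‖y - y₀‖ ^ 2 + c))

/-- Since y₀ lies in the open set Ω it is not on ∂Ω, so |y - y₀|² + c stays positive up to and
including c = 0, where the profile g is regular. -/
theorem continuousOn_boundaryIntegrand (hΩ : IsRegularBoundedDomain Ω)
    (hG : IsEntireProfile d K G G1 G2) (hg : IsFundamentalProfile d K g g1 g2)
    (z : EuclideanSpace ℝ (Fin d)) {y₀ : EuclideanSpace ℝ (Fin d)} (hy₀ : y₀ ∈ Ω) :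
    ContinuousOn (Function.uncurry (boundaryIntegrand Ω G G1 g g1 z y₀))
      (Icc 0 1 ×ˢ frontier Ω) := by
  have hν : ContinuousOn (fun p : ℝ × EuclideanSpace ℝ (Fin d) => outwardNormal Ω p.2)
      (Icc 0 1 ×ˢ frontier Ω) :=
    (continuousOn_outwardNormal hΩ.isOpen hΩ.hasC1Boundary).comp continuousOn_snd
      fun p hp => hp.2
  have hGc : Continuous G := continuous_iff_continuousAt.2 fun s => (hG.hasDerivAt s).continuousAt
  have hG1c : Continuous G1 :=
    continuous_iff_continuousAt.2 fun s => (hG.hasDerivAt' s).continuousAt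
  have hgc : ContinuousOn g (Ioi 0) := fun s hs =>
    (hg.hasDerivAt s hs).continuousAt.continuousWithinAt
  have hg1c : ContinuousOn g1 (Ioi 0) := fun s hs =>
    (hg.hasDerivAt' s hs).continuousAt.continuousWithinAt
  have hρ : Continuous fun p : ℝ × EuclideanSpace ℝ (Fin d) => ‖p.2 - y₀‖ ^ 2 + p.1 := by fun_prop
  have hmaps : MapsTo (fun p : ℝ × EuclideanSpace ℝ (Fin d) => ‖p.2 - y₀‖ ^ 2 + p.1)
      (Icc 0 1 ×ˢ frontier Ω) (Ioi 0) := fun p hp => by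
    have hne : p.2 ≠ y₀ := by
      rintro h
      have := hp.2
      rw [hΩ.isOpen.frontier_eq, h] at this
      exact this.2 hy₀
    have h1 : 0 < ‖p.2 - y₀‖ := norm_pos_iff.2 (sub_ne_zero.2 hne)
    have h2 : 0 ≤ p.1 := hp.1.1
    have h3 : 0 < ‖p.2 - y₀‖ ^ 2 := by positivity
    exact mem_Ioi.2 (by linarith)
  have c1 : ContinuousOn (fun p : ℝ × EuclideanSpace ℝ (Fin d) =>
      2 * ⟪p.2 - z, outwardNormal Ω p.2⟫_ℝ * G1 (‖p.2 - z‖ ^ 2)) (Icc 0 1 ×ˢ frontier Ω) := by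
    have ha : Continuous fun p : ℝ × EuclideanSpace ℝ (Fin d) => p.2 - z := by fun_prop
    have hb : Continuous fun p : ℝ × EuclideanSpace ℝ (Fin d) => G1 (‖p.2 - z‖ ^ 2) := by fun_prop
    exact (continuousOn_const.mul (ha.continuousOn.inner hν)).mul hb.continuousOn
  have c2 : Continuous fun p : ℝ × EuclideanSpace ℝ (Fin d) => (G (‖p.2 - z‖ ^ 2) : ℂ) := by
    fun_prop
  have c3 : ContinuousOn (fun p : ℝ × EuclideanSpace ℝ (Fin d) =>
      2 * ⟪p.2 - y₀, outwardNormal Ω p.2⟫_ℝ) (Icc 0 1 ×ˢ frontier Ω) := by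
    have ha : Continuous fun p : ℝ × EuclideanSpace ℝ (Fin d) => p.2 - y₀ := by fun_prop
    exact continuousOn_const.mul (ha.continuousOn.inner hν)
  exact ((Complex.continuous_ofReal.comp_continuousOn c1).mul
      (hgc.comp hρ.continuousOn hmaps)).sub
    (c2.continuousOn.mul ((Complex.continuous_ofReal.comp_continuousOn c3).mul
      (hg1c.comp hρ.continuousOn hmaps)))

/-- With v = G(|· - z|²) and w = g(|· - y₀|² + c), one has Δv = -K v and Δw = -K w - 4c g2. In
Green's identity the terms with K cancel. -/
theorem integral_boundaryIntegrand_of_pos (hΩ : IsRegularBoundedDomain Ω)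
    (hG : IsEntireProfile d K G G1 G2) (hg : IsFundamentalProfile d K g g1 g2)
    (z y₀ : EuclideanSpace ℝ (Fin d)) {c : ℝ} (hc : 0 < c) :
    ∫ y, boundaryIntegrand Ω G G1 g g1 z y₀ c y ∂(surfaceMeasure Ω)
      = ∫ y in Ω, (G (‖y - z‖ ^ 2) : ℂ) * (4 * c * g2 (‖y - y₀‖ ^ 2 + c)) := by
  have hpos : ∀ x : EuclideanSpace ℝ (Fin d), 0 < ‖x - y₀‖ ^ 2 + c := fun x => by positivity
  have hGd : ∀ x : EuclideanSpace ℝ (Fin d), HasDerivAt (fun s => (G s : ℂ))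
      ((G1 (‖x - z‖ ^ 2 + 0) : ℝ) : ℂ) (‖x - z‖ ^ 2 + 0) := fun x =>
    (hG.hasDerivAt _).ofReal_comp
  have hG1d : ∀ x : EuclideanSpace ℝ (Fin d), HasDerivAt (fun s => (G1 s : ℂ))
      ((G2 (‖x - z‖ ^ 2 + 0) : ℝ) : ℂ) (‖x - z‖ ^ 2 + 0) := fun x =>
    (hG.hasDerivAt' _).ofReal_comp
  have hG2c : Continuous fun x : EuclideanSpace ℝ (Fin d) => (G2 (‖x - z‖ ^ 2 + 0) : ℂ) := by
    have := hG.continuous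
    fun_prop
  have hgd := fun x : EuclideanSpace ℝ (Fin d) => hg.hasDerivAt _ (hpos x)
  have hg1d := fun x : EuclideanSpace ℝ (Fin d) => hg.hasDerivAt' _ (hpos x)
  have hg2c : Continuous fun x : EuclideanSpace ℝ (Fin d) => g2 (‖x - y₀‖ ^ 2 + c) :=
    hg.continuousOn.comp_continuous (by fun_prop) fun x => hpos x
  have hgreen := hΩ.green_identity
    (contDiff_radial (h := fun s => (G s : ℂ)) (h' := fun s => (G1 s : ℂ)) z 0 hGd
      (continuous_radial (h := fun s => (G1 s : ℂ)) (h' := fun s => (G2 s : ℂ)) z 0 hG1d))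
    (contDiff_fderiv_radial (h := fun s => (G s : ℂ)) (h1 := fun s => (G1 s : ℂ))
      (h2 := fun s => (G2 s : ℂ)) hGd hG1d hG2c)
    (contDiff_radial y₀ c hgd (continuous_radial y₀ c hg1d))
    (contDiff_fderiv_radial hgd hg1d hg2c)
  convert hgreen using 1
  · congr 1 with y
    rw [normalDeriv, normalDeriv, fderiv_radial_apply y₀ c (hgd y),
      fderiv_radial_apply (h := fun s => (G s : ℂ)) z 0 (hGd y)]
    simp only [boundaryIntegrand, Complex.real_smul, add_zero]
    push_cast
    ring
  · congr 1 with y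
    rw [lap_radial hgd hg1d, lap_radial (h := fun s => (G s : ℂ)) (h1 := fun s => (G1 s : ℂ))
      (h2 := fun s => (G2 s : ℂ)) hGd hG1d]
    simp only [add_zero]
    have e1 := hg.ode _ (hpos y)
    have e2 := congrArg (fun t : ℝ => (t : ℂ)) (hG.ode (‖y - z‖ ^ 2))
    push_cast at e1 e2 ⊢
    linear_combination (G (‖y - z‖ ^ 2) : ℂ) * e1 - g (‖y - y₀‖ ^ 2 + c) * e2

/-- Taking c = ε² → 0, the boundary side converges by continuity and the volume side by the Dirac
limit; the two limits coincide. -/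
theorem integral_boundaryIntegrand (hd : 0 < d) (hΩ : IsRegularBoundedDomain Ω)
    (hG : IsEntireProfile d K G G1 G2) (hg : IsFundamentalProfile d K g g1 g2)
    (z : EuclideanSpace ℝ (Fin d)) {y₀ : EuclideanSpace ℝ (Fin d)} (hy₀ : y₀ ∈ Ω) :
    ∫ y, boundaryIntegrand Ω G G1 g g1 z y₀ 0 y ∂(surfaceMeasure Ω) = G (‖y₀ - z‖ ^ 2) := by
  have hGc : Continuous G := continuous_iff_continuousAt.2 fun s => (hG.hasDerivAt s).continuousAt
  have hv : Continuous fun x : EuclideanSpace ℝ (Fin d) => (G (‖x - z‖ ^ 2) : ℂ) := by fun_prop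
  have hsq : Tendsto (fun ε : ℝ => ε ^ 2) (𝓝[>] 0) (𝓝[>] 0) := by
    refine tendsto_nhdsWithin_iff.2 ⟨?_, ?_⟩
    · simpa using ((continuous_pow 2).tendsto (0 : ℝ)).mono_left nhdsWithin_le_nhds
    · filter_upwards [self_mem_nhdsWithin] with ε hε
      exact pow_pos (mem_Ioi.1 hε) 2
  have h1 := (hΩ.tendsto_integral_surfaceMeasure
    (continuousOn_boundaryIntegrand hΩ hG hg z hy₀)).comp hsq
  have h2 := hg.tendsto_setIntegral hd hΩ.isOpen hΩ.isBounded hv hy₀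
  refine tendsto_nhds_unique h1 (h2.congr' ?_)
  filter_upwards [self_mem_nhdsWithin] with ε hε
  rw [Function.comp_apply,
    integral_boundaryIntegrand_of_pos hΩ hG hg z y₀ (pow_pos (mem_Ioi.1 hε) 2)]
  push_cast
  rfl

/-- The profile represents `greenΦ` only off the diagonal, but that covers a whole neighbourhood of
y, which is all the derivative sees. -/
theorem fderiv_radiatedField {k : ℝ} {N : ℕ} (α : Fin N → ℂ)
    (x : Fin N → EuclideanSpace ℝ (Fin d)) (hg : IsFundamentalProfile d K g g1 g2)
    (hΦ : ∀ x y : EuclideanSpace ℝ (Fin d), x ≠ y → greenΦ k x y = g (‖x - y‖ ^ 2))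
    {y : EuclideanSpace ℝ (Fin d)} (hy : ∀ j, y ≠ x j) (w : EuclideanSpace ℝ (Fin d)) :
    fderiv ℝ (radiatedField k α x) y w
      = ∑ j, α j * ((2 * ⟪y - x j, w⟫_ℝ : ℝ) * g1 (‖y - x j‖ ^ 2)) := by
  have heq : radiatedField k α x =ᶠ[𝓝 y] fun y => ∑ j, α j * g (‖y - x j‖ ^ 2 + 0) := by
    have hne : ∀ᶠ y' in 𝓝 y, ∀ j, y' ≠ x j :=
      eventually_all.2 fun j => isOpen_ne.mem_nhds (hy j)
    filter_upwards [hne] with y' hy'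
    simp only [radiatedField, add_zero]
    exact Finset.sum_congr rfl fun j _ => by rw [hΦ _ _ (hy' j)]
  have hd : ∀ j, HasFDerivAt (fun y => g (‖y - x j‖ ^ 2 + 0)) _ y := fun j =>
    hasFDerivAt_radial (x j) 0 (hg.hasDerivAt _ (by
      have := norm_pos_iff.2 (sub_ne_zero.2 (hy j))
      positivity))
  have hs : HasFDerivAt (fun y => ∑ j, α j * g (‖y - x j‖ ^ 2 + 0)) _ y :=
    HasFDerivAt.fun_sum fun j _ => (hd j).const_mul (α j)
  rw [heq.fderiv_eq, hs.fderiv, _root_.sum_apply]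
  refine Finset.sum_congr rfl fun j _ => ?_
  simp [inner_sub_left]

end Representation

end InverseSource

end

/-! ### Superposition over the point sources -/

theorem lemma1 {d : ℕ} (hd : d = 2 ∨ d = 3) {k : ℝ} (hk : 0 < k)
    {Ω : Set (EuclideanSpace ℝ (Fin d))} (hΩ : InverseSource.IsRegularBoundedDomain Ω)
    {N : ℕ} (α : Fin N → ℂ) (x : Fin N → EuclideanSpace ℝ (Fin d)) (hx : ∀ j, x j ∈ Ω)
    (z : EuclideanSpace ℝ (Fin d)) :
    Integrable (fun y =>
        ((InverseSource.normalDeriv Ω (fun w => InverseSource.imΦ k w z) y : ℝ) : ℂ)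
            * InverseSource.radiatedField k α x y
          - ((InverseSource.imΦ k y z : ℝ) : ℂ)
            * InverseSource.normalDeriv Ω (InverseSource.radiatedField k α x) y)
      (InverseSource.surfaceMeasure Ω) ∧
    ∫ y,
        (((InverseSource.normalDeriv Ω (fun w => InverseSource.imΦ k w z) y : ℝ) : ℂ)
            * InverseSource.radiatedField k α x y
          - ((InverseSource.imΦ k y z : ℝ) : ℂ)
            * InverseSource.normalDeriv Ω (InverseSource.radiatedField k α x) y)
        ∂(InverseSource.surfaceMeasure Ω)
      = ∑ j, α j * ((InverseSource.imΦ k (x j) z : ℝ) : ℂ) := by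
  have hd0 : 0 < d := by omega
  obtain ⟨G, G1, G2, hG, hGim⟩ := InverseSource.exists_isEntireProfile hd hk
  obtain ⟨g, g1, g2, hg, hgΦ⟩ := InverseSource.exists_isFundamentalProfile hd hk
  have hint : ∀ j, Integrable (InverseSource.boundaryIntegrand Ω G G1 g g1 z (x j) 0)
      (InverseSource.surfaceMeasure Ω) := fun j =>
    hΩ.integrable_surfaceMeasure
      ((InverseSource.continuousOn_boundaryIntegrand hΩ hG hg z (hx j)).comp
        (f := fun y => ((0 : ℝ), y)) (by fun_prop) fun y hy => ⟨⟨le_rfl, zero_le_one⟩, hy⟩)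
  -- The identity holds at every point of ∂Ω, which carries the surface measure and contains no
  -- source.
  have hae : (fun y => ∑ j, α j * InverseSource.boundaryIntegrand Ω G G1 g g1 z (x j) 0 y)
      =ᵐ[InverseSource.surfaceMeasure Ω] fun y =>
        ((InverseSource.normalDeriv Ω (fun w => InverseSource.imΦ k w z) y : ℝ) : ℂ)
            * InverseSource.radiatedField k α x y
          - ((InverseSource.imΦ k y z : ℝ) : ℂ)
            * InverseSource.normalDeriv Ω (InverseSource.radiatedField k α x) y := by
    filter_upwards [ae_restrict_mem isClosed_frontier.measurableSet] with y hy
    have hne : ∀ j, y ≠ x j := fun j h => by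
      rw [hΩ.isOpen.frontier_eq, h] at hy
      exact hy.2 (hx j)
    have hv : InverseSource.normalDeriv Ω (fun w => InverseSource.imΦ k w z) y
        = 2 * ⟪y - z, InverseSource.outwardNormal Ω y⟫_ℝ * G1 (‖y - z‖ ^ 2) := by
      have heq : (fun w => InverseSource.imΦ k w z) = fun w => G (‖w - z‖ ^ 2 + 0) := by
        funext w
        rw [hGim, add_zero]
      rw [InverseSource.normalDeriv, heq,
        InverseSource.fderiv_radial_apply z 0 (hG.hasDerivAt _), add_zero, smul_eq_mul]
    rw [hv, hGim, InverseSource.normalDeriv,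
      InverseSource.fderiv_radiatedField α x hg hgΦ hne, InverseSource.radiatedField,
      Finset.mul_sum, Finset.mul_sum, ← Finset.sum_sub_distrib]
    refine Finset.sum_congr rfl fun j _ => ?_
    rw [hgΦ _ _ (hne j), InverseSource.boundaryIntegrand, add_zero]
    ring
  constructor
  · exact (integrable_finsetSum _ fun j _ => (hint j).const_mul (α j)).congr hae
  · rw [← integral_congr_ae hae, integral_finsetSum _ fun j _ => (hint j).const_mul (α j)]
    refine Finset.sum_congr rfl fun j _ => ?_
    rw [integral_const_mul, InverseSource.integral_boundaryIntegrand hd0 hΩ hG hg z (hx j), hGim]
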